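/- Let $K\ge 1$ and $N_0\ge 1$ be integers. For integers $N_1,\dots,N_K$ with $N_k\ge N_0$ for all $k$ (in any order), let $\mathbf Q_1,\dots,\mathbf Q_K$ be independent random matrices, $\mathbf Q_k$ of size $N_k\times N_{k-1}$ with i.i.d. circularly symmetric complex Gaussian entries of mean zero and unit variance (density $e^{-|z|^2}/\pi$). Let $\mathbf H=\mathbf Q_K\mathbf Q_{K-1}\cdots\mathbf Q_1$ be the Rayleigh product channel with setting $(N_0,N_1,\dots,N_K)$, and for $q>0$ let $$\tilde R(N_0,\dots,N_K;q)=\mathbb E\big[\ln\det(\mathbf I+q\,\mathbf H^\dagger\mathbf H)\big]$$ be its ergodic capacity (nats per channel use). Call $q\prod_{k=1}^K N_k$ the signal-to-noise ratio (SNR) of the setting; it is the mean of each diagonal entry of $q\mathbf H^\dagger\mathbf H$. Let $\psi=\Gamma'/\Gamma$ be the digamma function, so that $\psi(n)=-\gamma+\sum_{r=1}^{n-1}\frac1r$ for integers $n\ge1$. Then the following hold. 1. The random variable $\ln\det(\mathbf I+q\mathbf H^\dagger\mathbf H)$ is integrable, for every such setting and every $q>0$. 2. (Increment over the all-square setting at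 high SNR.) With $K$ and $N_0$ fixed, for every $\varepsilon>0$ there is $S>0$ such that for all $N_1,\dots,N_K\ge N_0$ and all $q>0$ for which both settings $(N_0,N_1,\dots,N_K)$ and $(N_0,N_0,\dots,N_0)$ have SNR at least $S$, the increment $$\Delta\tilde R=\tilde R(N_0,N_1,\dots,N_K;q)-\tilde R(N_0,N_0,\dots,N_0;q)$$ satisfies $$\Big|\Delta\tilde R-\sum_{k=1}^K\sum_{\ell=1}^{N_0}\big[\psi(N_k-\ell+1)-\psi(N_0-\ell+1)\big]\Big|<\varepsilon .$$ In particular, for a fixed setting, $\Delta\tilde R$ tends to this double sum as $q\to\infty$. 3. For all $N_1,\dots,N_K\ge N_0$, $$\sum_{k=1}^K\sum_{\ell=1}^{N_0}\big[\psi(N_k-\ell+1)-\psi(N_0-\ell+1)\big]=\sum_{k=1}^K\sum_{\ell=1}^{N_0}\sum_{s=N_0}^{N_k-1}\frac1{s-\ell+1}.$$ 4. (One additional antenna at high SNR.) With $K$ and $N_0$ fixed, for every $\varepsilon>0$ there is $S>0$ such that for all $N_1,\dots,N_K\ge N_0$, all $k\in\{1,\dots,K\}$ and all $q>0$ with $q\prod_{j=1}^K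 N_j\ge S$, $$\Big|\tilde R(N_0,\dots,N_{k-1},N_k+1,N_{k+1},\dots,N_K;q)-\tilde R(N_0,\dots,N_K;q)-\sum_{\ell=1}^{N_0}\frac1{N_k-\ell+1}\Big|<\varepsilon .$$ -/

import Mathlib

open MeasureTheory ProbabilityTheory Matrix
open scoped NNReal

noncomputable section

namespace RayleighProduct

/-- The circularly symmetric complex Gaussian law with mean zero and unit variance: real and
imaginary parts are independent, centred, of variance `1/2` (density `exp (-|z|²) / π`). -/
def complexGaussian : Measure ℂ :=
  ((gaussianReal 0 (1 / 2 : ℝ≥0)).prod (gaussianReal 0 (1 / 2 : ℝ≥0))).map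
    (fun p : ℝ × ℝ => (p.1 : ℂ) + (p.2 : ℂ) * Complex.I)

/-- The law of an `m × n` Rayleigh channel: the entries are i.i.d. with law `complexGaussian`. -/
def rayleighLaw (m n : ℕ) : Measure (Fin m → Fin n → ℂ) :=
  Measure.pi fun _ => Measure.pi fun _ => complexGaussian

/-- The factors of a Rayleigh product channel with sizes `N 0, N 1, …, N K` (the values of `N`
beyond `K` play no role). The entry with index `k : Fin K` is the `(k + 1)`-st factor
`Q_{k+1}`, of size `N (k + 1) × N k`. -/
abbrev Factors (K : ℕ) (N : ℕ → ℕ) : Type :=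
  (k : Fin K) → Fin (N (k + 1)) → Fin (N k) → ℂ

/-- The joint law of the factors: they are independent Rayleigh channels. -/
def factorsLaw (K : ℕ) (N : ℕ → ℕ) : Measure (Factors K N) :=
  Measure.pi fun k : Fin K => rayleighLaw (N (k + 1)) (N k)

/-- The product channel `H = Q_K * Q_{K-1} * ⋯ * Q_1`, of size `N K × N 0`. -/
def channel : (K : ℕ) → (N : ℕ → ℕ) → Factors K N → Matrix (Fin (N K)) (Fin (N 0)) ℂ
  | 0, _, _ => 1
  | K + 1, N, Q =>
      (Matrix.of (Q (Fin.last K)) : Matrix (Fin (N (K + 1))) (Fin (N K)) ℂ) *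
        channel K N (fun k => Q k.castSucc)

/-- The capacity `ln det (I + q Hᴴ H)` in nats per channel use, for given factors. The
determinant of this positive definite matrix is a positive real, read off by `re`. -/
def capacity (K : ℕ) (N : ℕ → ℕ) (q : ℝ) (Q : Factors K N) : ℝ :=
  Real.log (((1 : Matrix (Fin (N 0)) (Fin (N 0)) ℂ) +
    (q : ℂ) • ((channel K N Q)ᴴ * channel K N Q)).det).re

/-- The ergodic capacity: the mean of `capacity` over the random factors. -/
def ergodicCapacity (K : ℕ) (N : ℕ → ℕ) (q : ℝ) : ℝ :=
  ∫ Q, capacity K N q Q ∂(factorsLaw K N)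

/-- The signal-to-noise ratio `q * N 1 * ⋯ * N K`, which is the mean of each diagonal entry of
`q Hᴴ H`. -/
def snr (K : ℕ) (N : ℕ → ℕ) (q : ℝ) : ℝ :=
  q * ∏ k ∈ Finset.Icc 1 K, (N k : ℝ)

/-- The digamma function on the real line, `ψ = Γ' / Γ`. -/
def digamma (x : ℝ) : ℝ := (Complex.digamma (x : ℂ)).re

end RayleighProduct

end

noncomputable section

namespace RayleighProduct

/-!
For an almost surely invertible Gram matrix, `log det (1 + q Hᴴ H)` equals
`N₀ log q + log det (Hᴴ H) + log det (1 + (q Hᴴ H)⁻¹)`, and since `log (1 + t) ≤ 2 √t` the last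
term lies between `0` and `2 N₀ √(tr (Hᴴ H)⁻¹ / q)`. The means of `log det (Hᴴ H)` and
`√(tr (Hᴴ H)⁻¹)` are treated factor by factor. Writing `Q_{K-1} ⋯ Q_1 = U R` with `U` an isometry,
unitary invariance makes `Q_K U` a Gaussian matrix of size `N_K × N₀`, so that the new factor
multiplies the Gram determinant by an independent one, and the trace of the inverse Gram matrix by
at most an independent one.

For a single Gaussian matrix, the squared distance from a column to the span of `n` others is
Gamma distributed with parameter `N_k - n`. The Gram determinant is a product of such distances,
which gives the digamma sums as the mean of its logarithm, and the trace of the inverse Gram matrix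
is the sum of the reciprocals of such distances. The square root of each reciprocal has mean at
most `2 √(N₀ / N_k)`, so the error is `O(1 / √SNR)` uniformly in the setting, and the increments
are differences of the digamma sums.
-/

section GammaMeasure

open Set Filter Topology

lemma measurable_gammaPDF (a r : ℝ) : Measurable (gammaPDF a r) :=
  (measurable_gammaPDFReal a r).ennreal_ofReal

lemma ae_gammaMeasure_pos (a r : ℝ) : ∀ᵐ x ∂gammaMeasure a r, 0 < x := by
  rw [gammaMeasure, ae_withDensity_iff (measurable_gammaPDF a r)]
  filter_upwards [Measure.ae_ne volume 0] with x hx hpdf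
  exact (not_lt.1 fun hneg => hpdf (gammaPDF_of_neg hneg)).lt_of_ne' hx

variable {a r : ℝ}

lemma integral_gammaMeasure (ha : 0 < a) (hr : 0 < r) (f : ℝ → ℝ) :
    ∫ x, f x ∂gammaMeasure a r = ∫ x, gammaPDFReal a r x * f x := by
  rw [gammaMeasure, integral_withDensity_eq_integral_toReal_smul
    (measurable_gammaPDF a r) (ae_of_all _ fun _ => ENNReal.ofReal_lt_top)]
  simp only [gammaPDF, ENNReal.toReal_ofReal (gammaPDFReal_nonneg ha hr _), smul_eq_mul]

lemma integrable_and_integral_eq_of_gammaPDFReal_mul {b s c : ℝ} {f : ℝ → ℝ}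
    (ha : 0 < a) (hr : 0 < r) (hb : 0 < b) (hs : 0 < s)
    (h : ∀ x, 0 < x → gammaPDFReal a r x * f x = c * gammaPDFReal b s x) :
    Integrable f (gammaMeasure a r) ∧ ∫ x, f x ∂gammaMeasure a r = c := by
  have hpdf {a r : ℝ} (ha : 0 < a) (hr : 0 < r) : Integrable (gammaPDFReal a r) ∧
      ∫ x, gammaPDFReal a r x = 1 := by
    have := isProbabilityMeasure_gammaMeasure ha hr
    have h1 := integral_gammaMeasure ha hr fun _ => 1
    simp only [mul_one, integral_const, probReal_univ, smul_eq_mul] at h1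
    exact ⟨.of_integral_ne_zero (by simp [← h1]), h1.symm⟩
  have hae : (fun x => gammaPDFReal a r x * f x) =ᵐ[volume]
      fun x => c * gammaPDFReal b s x := by
    filter_upwards [Measure.ae_ne volume 0] with x hx
    rcases hx.lt_or_gt with hneg | hpos
    · simp [gammaPDFReal, hneg.not_ge]
    · exact h x hpos
  constructor
  · rw [gammaMeasure, integrable_withDensity_iff (measurable_gammaPDF a r)
      (ae_of_all _ fun _ => ENNReal.ofReal_lt_top)]
    simp only [gammaPDF, ENNReal.toReal_ofReal (gammaPDFReal_nonneg ha hr _), mul_comm (f _)]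
    exact ((hpdf hb hs).1.const_mul c).congr hae.symm
  · rw [integral_gammaMeasure ha hr, integral_congr_ae hae, integral_const_mul, (hpdf hb hs).2,
      mul_one]

lemma integrable_and_integral_exp_mul_log_gammaMeasure (ha : 0 < a) (hr : 0 < r) {s : ℝ}
    (hs : 0 < a + s) :
    Integrable (fun x => Real.exp (s * Real.log x)) (gammaMeasure a r) ∧
      ∫ x, Real.exp (s * Real.log x) ∂gammaMeasure a r =
        Real.Gamma (a + s) / (Real.Gamma a * r ^ s) := by
  refine integrable_and_integral_eq_of_gammaPDFReal_mul ha hr hs hr fun x hx => ?_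
  have hΓ : Real.Gamma (a + s) ≠ 0 := (Real.Gamma_pos_of_pos hs).ne'
  have hrs : r ^ s ≠ 0 := (Real.rpow_pos_of_pos hr s).ne'
  rw [gammaPDFReal, gammaPDFReal, if_pos hx.le, if_pos hx.le, mul_comm s,
    ← Real.rpow_def_of_pos hx, Real.rpow_add hr, add_sub_right_comm, Real.rpow_add hx]
  field_simp

lemma integrable_and_integral_exp_mul_gammaMeasure (ha : 0 < a) (hr : 0 < r) {t : ℝ}
    (ht : t < r) :
    Integrable (fun x => Real.exp (t * x)) (gammaMeasure a r) ∧
      ∫ x, Real.exp (t * x) ∂gammaMeasure a r = (1 - t / r) ^ (-a) := by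
  have hrt : 0 < r - t := sub_pos.2 ht
  refine integrable_and_integral_eq_of_gammaPDFReal_mul ha hr ha hrt fun x hx => ?_
  rw [gammaPDFReal, gammaPDFReal, if_pos hx.le, if_pos hx.le, one_sub_div hr.ne',
    Real.rpow_neg (by positivity), Real.div_rpow hrt.le hr.le,
    show -(r * x) = -((r - t) * x) + -(t * x) by ring, Real.exp_add, Real.exp_neg (t * x)]
  have := (Real.rpow_pos_of_pos hrt a).ne'
  field_simp

lemma complexMGF_id_gammaMeasure (ha : 0 < a) (hr : 0 < r) {z : ℂ} (hz : z.re < r) :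
    complexMGF id (gammaMeasure a r) z = (1 - z / r) ^ (-a : ℂ) := by
  have := isProbabilityMeasure_gammaMeasure ha hr
  have hsub : Iio r ⊆ integrableExpSet id (gammaMeasure a r) := fun t ht =>
    (integrable_and_integral_exp_mul_gammaMeasure ha hr ht).1
  have hleft : AnalyticOnNhd ℂ (complexMGF id (gammaMeasure a r)) {z | z.re < r} :=
    analyticOnNhd_complexMGF.mono fun z hz => interior_maximal hsub isOpen_Iio hz
  have hright : AnalyticOnNhd ℂ (fun z : ℂ => (1 - z / r) ^ (-a : ℂ)) {z | z.re < r} := by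
    refine fun z (hz : z.re < r) => AnalyticAt.cpow (by fun_prop) analyticAt_const (.inl ?_)
    rw [Complex.sub_re, Complex.one_re, Complex.div_ofReal_re, sub_pos, div_lt_one hr]
    exact hz
  have hreal (t : ℝ) (ht : t < r) :
      complexMGF id (gammaMeasure a r) t = (1 - t / r : ℂ) ^ (-a : ℂ) := by
    rw [complexMGF_ofReal, mgf, funext fun x => congrArg (fun y => Real.exp (t * y)) (id_eq x),
      (integrable_and_integral_exp_mul_gammaMeasure ha hr ht).2,
      Complex.ofReal_cpow (by rw [sub_nonneg, div_le_one hr]; exact ht.le)]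
    push_cast
    rfl
  refine hleft.eqOn_of_preconnected_of_frequently_eq hright
    (convex_halfSpace_re_lt r).isPreconnected (z₀ := 0) (by simpa using hr) ?_ hz
  have hofReal : Tendsto ((↑) : ℝ → ℂ) (𝓝[≠] 0) (𝓝[≠] 0) :=
    tendsto_nhdsWithin_iff.2 ⟨(Complex.continuous_ofReal.tendsto' 0 0 rfl).mono_left inf_le_left,
      eventually_nhdsWithin_of_forall fun t ht => Complex.ofReal_ne_zero.2 ht⟩
  exact hofReal.frequently
    ((eventually_nhdsWithin_of_eventually_nhds (Iio_mem_nhds hr)).mono hreal).frequently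

lemma charFun_gammaMeasure (ha : 0 < a) (hr : 0 < r) (t : ℝ) :
    charFun (gammaMeasure a r) t = (1 - t * Complex.I / r) ^ (-a : ℂ) := by
  rw [← complexMGF_id_mul_I, complexMGF_id_gammaMeasure ha hr (by simpa using hr)]

lemma ofReal_ne_neg_natCast {x : ℝ} (hx : 0 < x) (m : ℕ) : (x : ℂ) ≠ -m := fun h => by
  have hxm : x = -m := by exact_mod_cast h
  linarith [m.cast_nonneg (α := ℝ)]

lemma hasDerivAt_Gamma (ha : 0 < a) :
    HasDerivAt Real.Gamma (digamma a * Real.Gamma a) a := by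
  have hderiv :=
    (Complex.differentiableAt_Gamma a (ofReal_ne_neg_natCast ha)).hasDerivAt.real_of_complex
  have hre : (deriv Complex.Gamma a).re = digamma a * Real.Gamma a := by
    rw [digamma, Complex.digamma, logDeriv_apply, Complex.Gamma_ofReal, Complex.div_ofReal_re,
      div_mul_cancel₀ _ (Real.Gamma_pos_of_pos ha).ne']
  rw [hre] at hderiv
  exact hderiv.congr_of_eventuallyEq
    (.of_forall fun x => by simp only [Complex.Gamma_ofReal, Complex.ofReal_re])

lemma zero_mem_interior_integrableExpSet_log_gammaMeasure (ha : 0 < a) (hr : 0 < r) :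
    0 ∈ interior (integrableExpSet Real.log (gammaMeasure a r)) := by
  refine mem_interior.2 ⟨Ioi (-a), fun s (hs : -a < s) => ?_, isOpen_Ioi, by simpa using ha⟩
  exact (integrable_and_integral_exp_mul_log_gammaMeasure ha hr (by linarith)).1

lemma integrable_log_gammaMeasure (ha : 0 < a) (hr : 0 < r) :
    Integrable Real.log (gammaMeasure a r) :=
  integrable_of_mem_interior_integrableExpSet
    (zero_mem_interior_integrableExpSet_log_gammaMeasure ha hr)

lemma integral_log_gammaMeasure (ha : 0 < a) (hr : 0 < r) :
    ∫ x, Real.log x ∂gammaMeasure a r = digamma a - Real.log r := by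
  have hΓ : Real.Gamma a ≠ 0 := (Real.Gamma_pos_of_pos ha).ne'
  have hmgf : mgf Real.log (gammaMeasure a r) =ᶠ[𝓝 0]
      fun s => Real.Gamma (a + s) / (Real.Gamma a * r ^ s) := by
    filter_upwards [Ioi_mem_nhds (neg_lt_zero.2 ha)] with s hs
    rw [mem_Ioi] at hs
    exact (integrable_and_integral_exp_mul_log_gammaMeasure ha hr (by linarith)).2
  have hnum : HasDerivAt (fun s => Real.Gamma (a + s)) (digamma a * Real.Gamma a) 0 := by
    simpa using (by simpa using hasDerivAt_Gamma ha :
      HasDerivAt Real.Gamma (digamma a * Real.Gamma a) (a + 0)).comp_const_add a 0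
  have hden : HasDerivAt (fun s : ℝ => Real.Gamma a * r ^ s) (Real.Gamma a * Real.log r) 0 := by
    simpa using (Real.hasStrictDerivAt_const_rpow hr 0).hasDerivAt.const_mul (Real.Gamma a)
  rw [← deriv_mgf_zero (zero_mem_interior_integrableExpSet_log_gammaMeasure ha hr),
    hmgf.deriv_eq, (hnum.fun_div hden (by simpa using hΓ)).deriv]
  simp only [add_zero, Real.rpow_zero, mul_one]
  field_simp

lemma Gamma_sub_half_le (ha : 1 ≤ a) :
    Real.Gamma (a - 1 / 2) ≤ 2 / √a * Real.Gamma a := by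
  have ha0 : 0 < a := by linarith
  have hΓ := Real.Gamma_pos_of_pos ha0
  have hconv := Real.Gamma_mul_add_mul_le_rpow_Gamma_mul_rpow_Gamma ha0 (by linarith : 0 < a + 1)
    (by norm_num : (0 : ℝ) < 1 / 2) (by norm_num : (0 : ℝ) < 1 / 2) (by norm_num)
  rw [Real.Gamma_add_one ha0.ne', ← Real.sqrt_eq_rpow, ← Real.sqrt_eq_rpow,
    ← Real.sqrt_mul hΓ.le, mul_left_comm, Real.sqrt_mul ha0.le, Real.sqrt_mul_self hΓ.le,
    show 1 / 2 * a + 1 / 2 * (a + 1) = a - 1 / 2 + 1 by ring,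
    Real.Gamma_add_one (by linarith)] at hconv
  have hsqrt : 0 < √a := Real.sqrt_pos.2 ha0
  have : (a / 2) * Real.Gamma (a - 1 / 2) ≤ √a * Real.Gamma a :=
    (mul_le_mul_of_nonneg_right (by linarith)
      (Real.Gamma_pos_of_pos (by linarith)).le).trans hconv
  rw [div_mul_eq_mul_div, le_div_iff₀ hsqrt]
  nlinarith [Real.sq_sqrt ha0.le, hsqrt]

lemma lintegral_sqrt_inv_gammaMeasure_le (ha : 1 ≤ a) :
    ∫⁻ x, ENNReal.ofReal √x⁻¹ ∂gammaMeasure a 1 ≤ ENNReal.ofReal (2 / √a) := by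
  have ha0 : 0 < a := by linarith
  obtain ⟨hint, hval⟩ := integrable_and_integral_exp_mul_log_gammaMeasure ha0 one_pos
    (s := -(1 / 2)) (by linarith)
  have hae : (fun x => ENNReal.ofReal √x⁻¹) =ᵐ[gammaMeasure a 1]
      fun x => ENNReal.ofReal (Real.exp (-(1 / 2) * Real.log x)) := by
    filter_upwards [ae_gammaMeasure_pos a 1] with x hx
    rw [mul_comm, ← Real.rpow_def_of_pos hx, Real.rpow_neg hx.le, ← Real.sqrt_eq_rpow,
      Real.sqrt_inv]
  rw [lintegral_congr_ae hae, ← ofReal_integral_eq_lintegral_ofReal hint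
    (ae_of_all _ fun x => (Real.exp_pos _).le), hval, Real.one_rpow, mul_one, ← sub_eq_add_neg]
  exact ENNReal.ofReal_le_ofReal
    (div_le_of_le_mul₀ (Real.Gamma_pos_of_pos ha0).le (by positivity) (Gamma_sub_half_le ha))

lemma gammaMeasure_conv {b : ℝ} (ha : 0 < a) (hb : 0 < b) (hr : 0 < r) :
    gammaMeasure a r ∗ gammaMeasure b r = gammaMeasure (a + b) r := by
  have := isProbabilityMeasure_gammaMeasure ha hr
  have := isProbabilityMeasure_gammaMeasure hb hr
  have := isProbabilityMeasure_gammaMeasure (add_pos ha hb) hr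
  refine Measure.ext_of_charFun (funext fun t => ?_)
  rw [charFun_conv, charFun_gammaMeasure ha hr, charFun_gammaMeasure hb hr,
    charFun_gammaMeasure (add_pos ha hb) hr, Complex.ofReal_add, neg_add, Complex.cpow_add]
  exact fun h => by simpa using congrArg Complex.re h

lemma measurePreserving_sum_gammaMeasure {ι : Type*} [Fintype ι] [Nonempty ι] {a : ι → ℝ}
    (ha : ∀ i, 0 < a i) (hr : 0 < r) :
    MeasurePreserving (fun x : ι → ℝ => ∑ i, x i) (Measure.pi fun i => gammaMeasure (a i) r)
      (gammaMeasure (∑ i, a i) r) := by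
  have (i : ι) := isProbabilityMeasure_gammaMeasure (ha i) hr
  have hsum : 0 < ∑ i, a i := Finset.sum_pos (fun i _ => ha i) Finset.univ_nonempty
  have := isProbabilityMeasure_gammaMeasure hsum hr
  refine ⟨by fun_prop, Measure.ext_of_charFun (funext fun t => ?_)⟩
  have hne : 1 - t * Complex.I / r ≠ 0 := fun h => by simpa using congrArg Complex.re h
  rw [charFun_map_sum_pi_eq_prod, Finset.prod_apply, charFun_gammaMeasure hsum hr]
  simp only [charFun_gammaMeasure (ha _) hr, Complex.cpow_def_of_ne_zero hne]
  rw [← Complex.exp_sum, ← Finset.mul_sum, Finset.sum_neg_distrib, Complex.ofReal_sum]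

lemma ofReal_mul_cpow {c : ℝ} (hc : 0 < c) (z s : ℂ) : (c * z) ^ s = (c : ℂ) ^ s * z ^ s := by
  have hc0 : (c : ℂ) ≠ 0 := Complex.ofReal_ne_zero.2 hc.ne'
  rcases eq_or_ne z 0 with rfl | hz
  · rcases eq_or_ne s 0 with rfl | hs
    · simp only [Complex.cpow_zero, mul_one]
    · simp only [mul_zero, Complex.zero_cpow hs]
  · rw [Complex.cpow_def_of_ne_zero (mul_ne_zero hc0 hz), Complex.cpow_def_of_ne_zero hc0,
      Complex.cpow_def_of_ne_zero hz, Complex.log_ofReal_mul hc hz, Complex.ofReal_log hc.le,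
      add_mul, Complex.exp_add]

lemma integral_exp_mul_sq_gaussianReal {v : ℝ≥0} (hv : v ≠ 0) (t : ℝ) :
    ∫ x : ℝ, Complex.exp (t * (x ^ 2 : ℝ) * Complex.I) ∂gaussianReal 0 v =
      (1 - 2 * v * t * Complex.I) ^ (-(1 / 2) : ℂ) := by
  have hc : 0 < 2 * Real.pi * v := by positivity
  have hv0 : (v : ℂ) ≠ 0 := by exact_mod_cast hv
  set z : ℂ := 1 - 2 * v * t * Complex.I with hz
  have hzre : z.re = 1 := by simp [hz]
  have hzarg : z.arg ≠ Real.pi := fun h => by linarith [(Complex.arg_eq_pi_iff.1 h).1]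
  have hdensity (x : ℝ) : gaussianPDFReal 0 v x • Complex.exp (t * (x ^ 2 : ℝ) * Complex.I) =
      (√(2 * Real.pi * v))⁻¹ * Complex.exp (-(z / (2 * v : ℝ)) * x ^ 2) := by
    rw [gaussianPDFReal, Complex.real_smul, Complex.ofReal_mul, mul_assoc, Complex.ofReal_exp,
      ← Complex.exp_add, hz, Complex.ofReal_inv]
    congr 2
    push_cast
    field_simp
    ring
  have hpi : (Real.pi / (z / (2 * v : ℝ)) : ℂ) = (2 * Real.pi * v : ℝ) * z⁻¹ := by
    rw [div_div_eq_mul_div, div_eq_mul_inv, ← Complex.ofReal_mul]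
    ring_nf
  simp only [integral_gaussianReal_eq_integral_smul hv, hdensity]
  rw [integral_const_mul, integral_gaussian_complex, hpi, ofReal_mul_cpow hc,
    Complex.inv_cpow _ _ hzarg, ← Complex.cpow_neg, ← mul_assoc, Complex.ofReal_inv,
    Real.sqrt_eq_rpow, Complex.ofReal_cpow hc.le]
  · push_cast
    rw [inv_mul_cancel₀, one_mul]
    exact (Complex.cpow_ne_zero_iff_of_exponent_ne_zero (by norm_num)).2
      (mul_ne_zero (mul_ne_zero two_ne_zero (Complex.ofReal_ne_zero.2 Real.pi_ne_zero)) hv0)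
  · rw [Complex.div_ofReal_re, hzre]
    positivity

lemma measurePreserving_sq_gaussianReal {v : ℝ≥0} (hv : v ≠ 0) :
    MeasurePreserving (fun x : ℝ => x ^ 2) (gaussianReal 0 v)
      (gammaMeasure (1 / 2) (1 / (2 * v))) := by
  have hr : 0 < 1 / (2 * (v : ℝ)) := by positivity
  have := isProbabilityMeasure_gammaMeasure (one_half_pos (α := ℝ)) hr
  have := Measure.isProbabilityMeasure_map (μ := gaussianReal 0 v) (f := fun x : ℝ => x ^ 2)
    (by fun_prop)
  refine ⟨by fun_prop, Measure.ext_of_charFun (funext fun t => ?_)⟩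
  rw [charFun_gammaMeasure one_half_pos hr, charFun_apply_real,
    integral_map (by fun_prop) (by fun_prop), integral_exp_mul_sq_gaussianReal hv]
  push_cast
  congr 2
  rw [div_div_eq_mul_div, div_one]
  ring

end GammaMeasure

/-- The law of a vector with i.i.d. circularly symmetric complex Gaussian coordinates. -/
def gaussVec (ι : Type*) [Fintype ι] : Measure (ι → ℂ) := Measure.pi fun _ => complexGaussian

instance : IsProbabilityMeasure complexGaussian :=
  Measure.isProbabilityMeasure_map (by fun_prop)

lemma measurePreserving_sq_norm_complexGaussian :
    MeasurePreserving (fun z : ℂ => ‖z‖ ^ 2) complexGaussian (gammaMeasure 1 1) := by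
  have hsq : MeasurePreserving (fun x : ℝ => x ^ 2) (gaussianReal 0 (1 / 2))
      (gammaMeasure (1 / 2) 1) := by
    simpa using measurePreserving_sq_gaussianReal (v := 1 / 2) (by norm_num)
  have := isProbabilityMeasure_gammaMeasure (one_half_pos (α := ℝ)) one_pos
  have hconv := gammaMeasure_conv (one_half_pos (α := ℝ)) one_half_pos one_pos
  refine ⟨by fun_prop, ?_⟩
  rw [complexGaussian, Measure.map_map (by fun_prop) (by fun_prop)]
  have hcomp : (fun z : ℂ => ‖z‖ ^ 2) ∘ (fun p : ℝ × ℝ => (p.1 : ℂ) + p.2 * Complex.I) =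
      (fun p : ℝ × ℝ => p.1 + p.2) ∘ Prod.map (· ^ 2) (· ^ 2) := by
    ext p
    simp [Complex.sq_norm, Complex.normSq_add_mul_I]
  rw [hcomp, ← Measure.map_map (by fun_prop) (by fun_prop), (hsq.prod hsq).map_eq,
    ← Measure.conv, hconv, add_halves]

lemma measurePreserving_sum_sq_norm_gaussVec (ι : Type*) [Fintype ι] [Nonempty ι] :
    MeasurePreserving (fun x : ι → ℂ => ∑ i, ‖x i‖ ^ 2) (gaussVec ι)
      (gammaMeasure (Fintype.card ι) 1) := by
  have := isProbabilityMeasure_gammaMeasure one_pos one_pos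
  have hsum := measurePreserving_sum_gammaMeasure (ι := ι) (fun _ => one_pos) one_pos
  rw [Finset.sum_const, Finset.card_univ, nsmul_one] at hsum
  exact hsum.comp (measurePreserving_pi _ _ fun _ : ι => measurePreserving_sq_norm_complexGaussian)

lemma charFun_complexGaussian (w : ℂ) :
    charFun complexGaussian w = Complex.exp (-((‖w‖ ^ 2 / 4 : ℝ) : ℂ)) := by
  rw [charFun_apply, complexGaussian, integral_map (by fun_prop) (by fun_prop)]
  have hinner (p : ℝ × ℝ) : Complex.exp (inner ℝ ((p.1 : ℂ) + p.2 * Complex.I) w * Complex.I) =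
      Complex.exp (w.re * p.1 * Complex.I) * Complex.exp (w.im * p.2 * Complex.I) := by
    rw [← Complex.exp_add]
    simp only [Complex.inner, map_add, Complex.conj_ofReal, map_mul, Complex.conj_I, mul_neg,
      Complex.mul_re, Complex.add_re, Complex.ofReal_re, Complex.neg_re, Complex.I_re, mul_zero,
      Complex.ofReal_im, Complex.I_im, mul_one, sub_self, neg_zero, add_zero, Complex.add_im,
      Complex.neg_im, Complex.mul_im, zero_add, sub_neg_eq_add, Complex.ofReal_add,
      Complex.ofReal_mul]
    ring_nf
  simp only [hinner]
  rw [integral_prod_mul (fun x : ℝ => Complex.exp (w.re * x * Complex.I))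
    (fun y : ℝ => Complex.exp (w.im * y * Complex.I)), ← charFun_apply_real, ← charFun_apply_real,
    charFun_gaussianReal, charFun_gaussianReal, ← Complex.exp_add, Complex.sq_norm,
    Complex.normSq_apply]
  congr 1
  push_cast
  simp only [mul_zero, zero_mul, one_div, zero_sub]
  ring

section GaussVec

variable {ι κ : Type*} [Fintype ι] [Fintype κ]

instance : IsProbabilityMeasure (gaussVec ι) := by
  unfold gaussVec; infer_instance

lemma sum_sq_norm_eq_dotProduct (w : ι → ℂ) :
    ((∑ i, ‖w i‖ ^ 2 : ℝ) : ℂ) = star w ⬝ᵥ w := by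
  simp [dotProduct, ← Complex.conj_mul']

lemma exists_forall_strongDual_eq_re_dotProduct (L : StrongDual ℝ (ι → ℂ)) :
    ∃ w : ι → ℂ, ∀ x, L x = (star w ⬝ᵥ x).re := by
  classical
  refine ⟨fun i => L (Pi.single i 1) + L (Pi.single i Complex.I) * Complex.I, fun x => ?_⟩
  have hx : x = ∑ i, ((x i).re • (Pi.single i 1 : ι → ℂ) +
      (x i).im • (Pi.single i Complex.I : ι → ℂ)) := by
    ext j
    simp [Finset.sum_apply, Pi.single_apply, Finset.sum_add_distrib, Complex.re_add_im]
  conv_lhs => rw [hx]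
  simp [dotProduct, Complex.re_sum, mul_comm]

lemma integral_exp_re_dotProduct_gaussVec (w : ι → ℂ) :
    ∫ x, Complex.exp ((star w ⬝ᵥ x).re * Complex.I) ∂gaussVec ι =
      Complex.exp (-(star w ⬝ᵥ w) / 4) := by
  have hprod (x : ι → ℂ) : Complex.exp ((star w ⬝ᵥ x).re * Complex.I) =
      ∏ i, Complex.exp (inner ℝ (x i) (w i) * Complex.I) := by
    rw [← Complex.exp_sum, dotProduct, Complex.re_sum, Complex.ofReal_sum, Finset.sum_mul]
    simp [mul_comm]
  simp only [hprod]
  rw [gaussVec, integral_fintype_prod_eq_prod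
    (f := fun i (z : ℂ) => Complex.exp (inner ℝ z (w i) * Complex.I))]
  simp only [← charFun_apply, charFun_complexGaussian]
  rw [← Complex.exp_sum, ← sum_sq_norm_eq_dotProduct]
  push_cast
  rw [Finset.sum_neg_distrib, neg_div, Finset.sum_div]

lemma measurePreserving_mulVec_gaussVec [DecidableEq κ] {U : Matrix κ ι ℂ} (hU : U * Uᴴ = 1) :
    MeasurePreserving (U *ᵥ ·) (gaussVec ι) (gaussVec κ) := by
  have hcont : Continuous (U *ᵥ ·) := by fun_prop
  have := Measure.isProbabilityMeasure_map (μ := gaussVec ι) hcont.aemeasurable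
  refine ⟨hcont.measurable, Measure.ext_of_charFunDual (funext fun L => ?_)⟩
  obtain ⟨w, hw⟩ := exists_forall_strongDual_eq_re_dotProduct L
  have hadj (x : ι → ℂ) : star w ⬝ᵥ (U *ᵥ x) = star (Uᴴ *ᵥ w) ⬝ᵥ x := by
    rw [star_mulVec, conjTranspose_conjTranspose, dotProduct_mulVec]
  simp only [charFunDual_apply, hw]
  rw [integral_map hcont.aemeasurable (by fun_prop), integral_exp_re_dotProduct_gaussVec]
  simp only [hadj]
  rw [integral_exp_re_dotProduct_gaussVec, ← hadj, mulVec_mulVec, hU, one_mulVec]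

end GaussVec

lemma map_curry_pi {X : Type*} [MeasurableSpace X] (ι κ : Type*) [Fintype ι] [Fintype κ]
    (μ : Measure X) [IsProbabilityMeasure μ] :
    (Measure.pi fun _ : ι × κ => μ).map (MeasurableEquiv.curry ι κ X) =
      Measure.pi fun _ => Measure.pi fun _ => μ := by
  simpa only [Measure.infinitePi_eq_pi] using Measure.infinitePi_map_curry fun (_ : ι) (_ : κ) => μ

lemma measurePreserving_swap_pi {X : Type*} [MeasurableSpace X] (ι κ : Type*) [Fintype ι]
    [Fintype κ] (μ : Measure X) [IsProbabilityMeasure μ] :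
    MeasurePreserving (fun (Q : ι → κ → X) j i => Q i j)
      (Measure.pi fun _ => Measure.pi fun _ => μ) (Measure.pi fun _ => Measure.pi fun _ => μ) := by
  have hmeas : Measurable fun (Q : ι → κ → X) j i => Q i j := by fun_prop
  refine ⟨hmeas, ?_⟩
  rw [← map_curry_pi ι κ, ← map_curry_pi κ ι,
    ← Measure.pi_map_piCongrLeft (Equiv.prodComm ι κ) fun _ => μ,
    Measure.map_map hmeas (MeasurableEquiv.measurable _),
    Measure.map_map (MeasurableEquiv.measurable _) (MeasurableEquiv.measurable _)]
  rfl

section GramMatrix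

open scoped ComplexOrder

variable {ι κ p : Type*} [Fintype ι] [Fintype κ] [Fintype p]

lemma trace_conjTranspose_mul_self_re (A : Matrix ι κ ℂ) :
    (Aᴴ * A).trace.re = ∑ j, ∑ i, ‖A i j‖ ^ 2 := by
  simp only [trace, diag, mul_apply, conjTranspose_apply, Complex.re_sum]
  refine Finset.sum_congr rfl fun j _ => Finset.sum_congr rfl fun i _ => ?_
  rw [Complex.star_def, ← Complex.normSq_eq_conj_mul_self, Complex.ofReal_re, Complex.sq_norm]

lemma trace_conjTranspose_mul_self_mul_re_le (A : Matrix ι κ ℂ) (B : Matrix κ p ℂ) :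
    ((A * B)ᴴ * (A * B)).trace.re ≤ (Aᴴ * A).trace.re * (Bᴴ * B).trace.re := by
  simp only [trace_conjTranspose_mul_self_re]
  rw [Finset.sum_comm (f := fun j i => ‖A i j‖ ^ 2), mul_comm, Finset.sum_mul_sum]
  refine Finset.sum_le_sum fun j _ => Finset.sum_le_sum fun i _ => ?_
  have norm_le : ‖(A * B) i j‖ ≤ ∑ r, ‖B r j‖ * ‖A i r‖ := by
    rw [mul_apply]
    exact (norm_sum_le _ _).trans_eq (Finset.sum_congr rfl fun r _ => by rw [norm_mul, mul_comm])
  exact (pow_le_pow_left₀ (norm_nonneg _) norm_le 2).trans (Finset.sum_mul_sq_le_sq_mul_sq _ _ _)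

lemma exists_eq_conjTranspose_mul_self {M : Matrix κ κ ℂ} (hM : M.PosSemidef) :
    ∃ R : Matrix κ κ ℂ, M = Rᴴ * R := by
  classical
  open scoped MatrixOrder in
  exact CStarAlgebra.nonneg_iff_eq_star_mul_self.mp hM.nonneg

variable [DecidableEq κ]

/-- The Gram determinant `det (Aᴴ A)`, the squared volume spanned by the columns of `A`. It is a
nonnegative real, read off by `re`. -/
def gramDet (A : Matrix ι κ ℂ) : ℝ := (Aᴴ * A).det.re

/-- The trace of the inverse Gram matrix `(Aᴴ A)⁻¹`, which controls the error of the high-SNR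
expansion. It is a nonnegative real, read off by `re`. -/
def gramInvTrace (A : Matrix ι κ ℂ) : ℝ := ((Aᴴ * A)⁻¹).trace.re

lemma ofReal_gramDet (A : Matrix ι κ ℂ) : ((gramDet A : ℝ) : ℂ) = (Aᴴ * A).det :=
  (Complex.eq_re_of_ofReal_le (posSemidef_conjTranspose_mul_self A).det_nonneg).symm

lemma gramDet_nonneg (A : Matrix ι κ ℂ) : 0 ≤ gramDet A :=
  (Complex.le_def.mp (posSemidef_conjTranspose_mul_self A).det_nonneg).1

lemma isUnit_det_of_gramDet_ne_zero {A : Matrix ι κ ℂ} (hA : gramDet A ≠ 0) :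
    IsUnit (Aᴴ * A).det := by
  rw [isUnit_iff_ne_zero, ← ofReal_gramDet]
  exact Complex.ofReal_ne_zero.2 hA

lemma gramInvTrace_nonneg (A : Matrix ι κ ℂ) : 0 ≤ gramInvTrace A :=
  (Complex.le_def.mp (posSemidef_conjTranspose_mul_self A).inv.trace_nonneg).1

lemma gramDet_congr {A : Matrix ι κ ℂ} {B : Matrix p κ ℂ} (h : Aᴴ * A = Bᴴ * B) :
    gramDet A = gramDet B := by
  rw [gramDet, gramDet, h]

lemma gramInvTrace_congr {A : Matrix ι κ ℂ} {B : Matrix p κ ℂ} (h : Aᴴ * A = Bᴴ * B) :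
    gramInvTrace A = gramInvTrace B := by
  rw [gramInvTrace, gramInvTrace, h]

lemma gramDet_mul (G : Matrix ι κ ℂ) (R : Matrix κ κ ℂ) :
    gramDet (G * R) = gramDet G * gramDet R := by
  apply Complex.ofReal_injective
  rw [Complex.ofReal_mul, ofReal_gramDet, ofReal_gramDet, ofReal_gramDet, conjTranspose_mul,
    Matrix.mul_assoc, ← Matrix.mul_assoc Gᴴ, det_mul, det_mul, det_mul]
  ring

lemma gramInvTrace_mul_le (G : Matrix ι κ ℂ) (R : Matrix κ κ ℂ) :
    gramInvTrace (G * R) ≤ gramInvTrace G * gramInvTrace R := by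
  obtain ⟨M, hM⟩ := exists_eq_conjTranspose_mul_self (posSemidef_conjTranspose_mul_self G).inv
  have gram_R : (Rᴴ * R)⁻¹ = R⁻¹ᴴᴴ * R⁻¹ᴴ := by
    rw [Matrix.mul_inv_rev, conjTranspose_conjTranspose, conjTranspose_nonsing_inv]
  have gram_mul : ((G * R)ᴴ * (G * R))⁻¹ = (M * R⁻¹ᴴ)ᴴ * (M * R⁻¹ᴴ) := by
    rw [conjTranspose_mul, Matrix.mul_assoc, ← Matrix.mul_assoc Gᴴ, Matrix.mul_inv_rev,
      Matrix.mul_inv_rev, hM, conjTranspose_mul, conjTranspose_conjTranspose,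
      conjTranspose_nonsing_inv]
    simp only [Matrix.mul_assoc]
  rw [gramInvTrace, gramInvTrace, gramInvTrace, gram_mul, gram_R, hM]
  exact trace_conjTranspose_mul_self_mul_re_le M R⁻¹ᴴ

lemma exists_isometry_mul {A : Matrix ι κ ℂ} (hA : gramDet A ≠ 0) :
    ∃ (U : Matrix ι κ ℂ) (R : Matrix κ κ ℂ), Uᴴ * U = 1 ∧ A = U * R ∧ Rᴴ * R = Aᴴ * A := by
  have hdet := isUnit_det_of_gramDet_ne_zero hA
  obtain ⟨R, hR⟩ := exists_eq_conjTranspose_mul_self (posSemidef_conjTranspose_mul_self A)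
  have hRdet : IsUnit R.det := by
    rw [hR, det_mul] at hdet
    exact isUnit_of_mul_isUnit_right hdet
  refine ⟨A * R⁻¹, R, ?_, ?_, hR.symm⟩
  · rw [conjTranspose_mul, Matrix.mul_assoc, ← Matrix.mul_assoc Aᴴ, hR, conjTranspose_nonsing_inv,
      Matrix.mul_assoc, mul_nonsing_inv _ hRdet, Matrix.mul_one, nonsing_inv_mul]
    rwa [det_conjTranspose, isUnit_star]
  · rw [Matrix.mul_assoc, nonsing_inv_mul _ hRdet, Matrix.mul_one]

lemma exists_unitary_completion [DecidableEq ι] [DecidableEq p] {U : Matrix ι κ ℂ}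
    (hU : Uᴴ * U = 1) (hcard : Fintype.card κ + Fintype.card p = Fintype.card ι) :
    ∃ V : Matrix p ι ℂ, V * Vᴴ = 1 ∧ Vᴴ * V + U * Uᴴ = 1 := by
  let v : κ ⊕ p → EuclideanSpace ℂ ι := Sum.elim (fun j => WithLp.toLp 2 fun i => U i j) 0
  have inner_eq (b : OrthonormalBasis (κ ⊕ p) ℂ (EuclideanSpace ℂ ι)) (r s : κ ⊕ p) :
      ((of fun i r => b r i)ᴴ * of fun i r => b r i : Matrix (κ ⊕ p) (κ ⊕ p) ℂ) r s =
        inner ℂ (b r) (b s) := by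
    simp only [mul_apply, conjTranspose_apply, of_apply, PiLp.inner_apply, RCLike.inner_apply',
      RCLike.star_def]
  have hv : Orthonormal ℂ ((Set.range Sum.inl).domRestrict v) := by
    rw [orthonormal_iff_ite]
    rintro ⟨_, j, rfl⟩ ⟨_, k, rfl⟩
    refine Eq.trans ?_ ((congrFun₂ hU j k).trans ?_)
    · simp [v, mul_apply, PiLp.inner_apply, mul_comm]
    · rw [one_apply]
      exact if_congr (Subtype.ext_iff.trans Sum.inl_injective.eq_iff).symm rfl rfl
  obtain ⟨b, hb⟩ := hv.exists_orthonormalBasis_extension_of_card_eq (by simp [← hcard])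
  let V : Matrix p ι ℂ := of fun r i => star (b (Sum.inr r) i)
  have hW : (of fun i r => b r i : Matrix ι (κ ⊕ p) ℂ) = fromCols U Vᴴ := by
    ext i (j | r)
    · simpa [v] using congrArg (· i) (hb (Sum.inl j) ⟨j, rfl⟩)
    · simp [V]
  have hWW : (fromCols U Vᴴ)ᴴ * fromCols U Vᴴ = 1 := by
    rw [← hW]
    ext r s
    rw [inner_eq b, orthonormal_iff_ite.1 b.orthonormal, one_apply]
  rw [conjTranspose_fromCols_eq_fromRows_conjTranspose, conjTranspose_conjTranspose] at hWW
  refine ⟨V, ?_, ?_⟩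
  · rw [fromRows_mul_fromCols, ← fromBlocks_one] at hWW
    exact (fromBlocks_inj.1 hWW).2.2.2
  · rw [mul_eq_one_comm_of_card_eq _ _ _ (by simp [hcard]), fromCols_mul_fromRows] at hWW
    rwa [add_comm]

lemma exists_coisometry_add_projection_eq_one [DecidableEq ι] [DecidableEq p] {B : Matrix ι κ ℂ}
    (hB : gramDet B ≠ 0) (hcard : Fintype.card κ + Fintype.card p = Fintype.card ι) :
    ∃ V : Matrix p ι ℂ, V * Vᴴ = 1 ∧ Vᴴ * V + B * (Bᴴ * B)⁻¹ * Bᴴ = 1 := by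
  obtain ⟨U, R, hU, rfl, hR⟩ := exists_isometry_mul hB
  obtain ⟨V, hV, hVU⟩ := exists_unitary_completion (p := p) hU hcard
  have hRdet : IsUnit R.det := by
    have := isUnit_det_of_gramDet_ne_zero hB
    rw [← hR, det_mul] at this
    exact isUnit_of_mul_isUnit_right this
  have hRdet' : IsUnit Rᴴ.det := by rwa [det_conjTranspose, isUnit_star]
  refine ⟨V, hV, ?_⟩
  rw [← hVU, ← hR, Matrix.mul_inv_rev, conjTranspose_mul, Matrix.mul_assoc, Matrix.mul_assoc,
    Matrix.mul_assoc, nonsing_inv_mul_cancel_left _ _ hRdet', mul_nonsing_inv_cancel_left _ _ hRdet]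

lemma gramDet_fromCols [DecidableEq ι] [DecidableEq p] {q : Type*} [Fintype q]
    {B : Matrix ι κ ℂ} (hB : gramDet B ≠ 0) {V : Matrix q ι ℂ}
    (hV : Vᴴ * V + B * (Bᴴ * B)⁻¹ * Bᴴ = 1) (C : Matrix ι p ℂ) :
    gramDet (fromCols B C) = gramDet B * gramDet (V * C) := by
  have : Invertible (Bᴴ * B) := invertibleOfIsUnitDet _ (isUnit_det_of_gramDet_ne_zero hB)
  have schur_complement :
      Cᴴ * C - Cᴴ * B * (Bᴴ * B)⁻¹ * (Bᴴ * C) = (V * C)ᴴ * (V * C) := by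
    calc Cᴴ * C - Cᴴ * B * (Bᴴ * B)⁻¹ * (Bᴴ * C)
        = Cᴴ * (Vᴴ * V + B * (Bᴴ * B)⁻¹ * Bᴴ) * C - Cᴴ * B * (Bᴴ * B)⁻¹ * (Bᴴ * C) := by
          rw [hV, Matrix.mul_one]
      _ = (V * C)ᴴ * (V * C) := by
          rw [conjTranspose_mul]
          simp only [Matrix.mul_add, Matrix.add_mul, Matrix.mul_assoc]
          abel
  apply Complex.ofReal_injective
  rw [Complex.ofReal_mul, ofReal_gramDet, ofReal_gramDet, ofReal_gramDet,
    conjTranspose_fromCols_eq_fromRows_conjTranspose, fromRows_mul_fromCols, det_fromBlocks₁₁,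
    invOf_eq_nonsing_inv, schur_complement]

lemma gramDet_submatrix_equiv {κ' : Type*} [Fintype κ'] [DecidableEq κ'] (A : Matrix ι κ ℂ)
    (e : κ' ≃ κ) : gramDet (A.submatrix id e) = gramDet A := by
  have : (A.submatrix id e)ᴴ * A.submatrix id e = (Aᴴ * A).submatrix e e := rfl
  rw [gramDet, this, det_submatrix_equiv_self, gramDet]

lemma gramDet_eq_sum_sq_norm_of_unique [Unique κ] (A : Matrix ι κ ℂ) :
    gramDet A = ∑ i, ‖A i default‖ ^ 2 := by
  rw [gramDet, det_unique, ← Fintype.sum_unique fun j => (Aᴴ * A) j j]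
  exact (trace_conjTranspose_mul_self_re A).trans (Fintype.sum_unique _)

/-- The squared distance from the `j`-th column of `A` to the span of the other columns, provided
these are linearly independent, as a ratio of Gram determinants. It is `0` if they are not. -/
def colSqDist {n : ℕ} (A : Matrix ι (Fin (n + 1)) ℂ) (j : Fin (n + 1)) : ℝ :=
  gramDet A / gramDet (A.submatrix id j.succAbove)

lemma colSqDist_nonneg {n : ℕ} (A : Matrix ι (Fin (n + 1)) ℂ) (j : Fin (n + 1)) :
    0 ≤ colSqDist A j :=
  div_nonneg (gramDet_nonneg _) (gramDet_nonneg _)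

lemma colSqDist_eq_sum_sq_norm_mulVec [DecidableEq ι] {n : ℕ} {A : Matrix ι (Fin (n + 1)) ℂ}
    {B : Matrix ι (Fin n) ℂ} {j : Fin (n + 1)} (hAB : A.submatrix id j.succAbove = B)
    (hB : gramDet B ≠ 0) {V : Matrix p ι ℂ} (hV : Vᴴ * V + B * (Bᴴ * B)⁻¹ * Bᴴ = 1) :
    colSqDist A j = ∑ i, ‖(V *ᵥ A.col j) i‖ ^ 2 := by
  let e : Fin n ⊕ Unit ≃ Fin (n + 1) :=
    (Equiv.optionEquivSumPUnit (Fin n)).symm.trans (finSuccEquiv' j).symm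
  have splitCols : A.submatrix id e = fromCols B (replicateCol Unit (A.col j)) := by
    ext i (k | k) <;> simp [e, ← hAB]
  rw [colSqDist, hAB, ← gramDet_submatrix_equiv A e, splitCols, gramDet_fromCols hB hV,
    mul_div_cancel_left₀ _ hB, gramDet_eq_sum_sq_norm_of_unique]
  rfl

lemma gramInvTrace_eq_sum_inv_colSqDist {n : ℕ} (A : Matrix ι (Fin (n + 1)) ℂ) :
    gramInvTrace A = ∑ j, (colSqDist A j)⁻¹ := by
  rw [gramInvTrace, inv_def, trace_smul, Ring.inverse_eq_inv', ← ofReal_gramDet,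
    ← Complex.ofReal_inv, smul_eq_mul, Complex.re_ofReal_mul, trace, Complex.re_sum,
    Finset.mul_sum]
  refine Finset.sum_congr rfl fun j _ => ?_
  rw [diag_apply, adjugate_fin_succ_eq_det_submatrix, Even.neg_one_pow ⟨_, rfl⟩, one_mul,
    colSqDist, inv_div, div_eq_inv_mul]
  rfl

end GramMatrix

section HighPower

open scoped ComplexOrder

variable {ι κ : Type*} [Fintype ι] [Fintype κ] [DecidableEq κ]

lemma det_one_add_eq_prod_eigenvalues {M : Matrix κ κ ℂ} (hM : M.IsHermitian) :
    (1 + M).det = ((∏ i, (1 + hM.eigenvalues i) : ℝ) : ℂ) := by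
  have charpoly_neg_one := congrArg (Polynomial.eval (-1)) hM.charpoly_eq
  rw [eval_charpoly, Polynomial.eval_prod] at charpoly_neg_one
  rw [show 1 + M = -(scalar κ (-1) - M) by
    rw [map_neg, map_one, neg_sub, sub_neg_eq_add, add_comm], det_neg, charpoly_neg_one,
    ← Finset.card_univ, ← Finset.prod_const, ← Finset.prod_mul_distrib, Complex.ofReal_prod]
  refine Finset.prod_congr rfl fun i _ => ?_
  rw [Polynomial.eval_sub, Polynomial.eval_X, Polynomial.eval_C]
  push_cast
  simp only [Complex.coe_algebraMap]
  ring

lemma log_one_add_le_two_mul_sqrt {t : ℝ} (ht : 0 ≤ t) : Real.log (1 + t) ≤ 2 * √t :=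
  calc Real.log (1 + t) ≤ Real.log ((1 + √t) ^ 2) :=
        Real.log_le_log (by positivity) (by nlinarith [Real.sq_sqrt ht, Real.sqrt_nonneg t])
    _ = 2 * Real.log (1 + √t) := by rw [Real.log_pow, Nat.cast_ofNat]
    _ ≤ 2 * √t := by linarith [Real.log_le_sub_one_of_pos (x := 1 + √t) (by positivity)]

lemma one_le_re_det_one_add {M : Matrix κ κ ℂ} (hM : M.PosSemidef) : 1 ≤ (1 + M).det.re := by
  rw [det_one_add_eq_prod_eigenvalues hM.isHermitian, Complex.ofReal_re]
  exact Finset.one_le_prod fun i _ => by linarith [hM.eigenvalues_nonneg i]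

lemma log_re_det_one_add_le {M : Matrix κ κ ℂ} (hM : M.PosSemidef) :
    Real.log (1 + M).det.re ≤ 2 * Fintype.card κ * √M.trace.re := by
  have trace_eq : M.trace.re = ∑ i, hM.isHermitian.eigenvalues i := by
    rw [hM.isHermitian.trace_eq_sum_eigenvalues, Complex.re_sum]
    rfl
  have eigenvalue_le (i : κ) : hM.isHermitian.eigenvalues i ≤ M.trace.re :=
    trace_eq ▸ Finset.single_le_sum (fun k _ => hM.eigenvalues_nonneg k) (Finset.mem_univ i)
  rw [det_one_add_eq_prod_eigenvalues hM.isHermitian, Complex.ofReal_re,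
    Real.log_prod fun i _ => (add_pos_of_pos_of_nonneg one_pos (hM.eigenvalues_nonneg i)).ne']
  calc ∑ i, Real.log (1 + hM.isHermitian.eigenvalues i) ≤ ∑ _i : κ, 2 * √M.trace.re :=
        Finset.sum_le_sum fun i _ => (log_one_add_le_two_mul_sqrt (hM.eigenvalues_nonneg i)).trans
          (by gcongr; exact eigenvalue_le i)
    _ = 2 * Fintype.card κ * √M.trace.re := by
        rw [Finset.sum_const, Finset.card_univ, nsmul_eq_mul]
        ring

lemma abs_log_det_one_add_smul_sub_le {A : Matrix ι κ ℂ} (hA : gramDet A ≠ 0) {q : ℝ}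
    (hq : 0 < q) :
    |Real.log (1 + (q : ℂ) • (Aᴴ * A)).det.re -
        (Fintype.card κ * Real.log q + Real.log (gramDet A))| ≤
      2 * Fintype.card κ * √(gramInvTrace A / q) := by
  let M : Matrix κ κ ℂ := ((q⁻¹ : ℝ) : ℂ) • (Aᴴ * A)⁻¹
  have hM : M.PosSemidef := (posSemidef_conjTranspose_mul_self A).inv.smul
    (Complex.zero_le_real.2 (inv_pos.2 hq).le)
  have factor : 1 + (q : ℂ) • (Aᴴ * A) = ((q : ℂ) • (Aᴴ * A)) * (1 + M) := by
    rw [Matrix.mul_add, Matrix.mul_one, Matrix.smul_mul, Matrix.mul_smul,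
      mul_nonsing_inv _ (isUnit_det_of_gramDet_ne_zero hA), smul_smul, Complex.ofReal_inv,
      mul_inv_cancel₀ (Complex.ofReal_ne_zero.2 hq.ne'), one_smul, add_comm]
  have re_det : (1 + (q : ℂ) • (Aᴴ * A)).det.re =
      q ^ Fintype.card κ * gramDet A * (1 + M).det.re := by
    rw [factor, det_mul, det_smul, ← ofReal_gramDet, ← Complex.ofReal_pow, ← Complex.ofReal_mul,
      Complex.re_ofReal_mul]
  have re_trace : M.trace.re = gramInvTrace A / q := by
    rw [trace_smul, smul_eq_mul, Complex.re_ofReal_mul, gramInvTrace, inv_mul_eq_div]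
  have one_le := one_le_re_det_one_add hM
  rw [re_det, Real.log_mul (by positivity) (by positivity), Real.log_mul (by positivity) hA,
    Real.log_pow, add_sub_cancel_left, abs_of_nonneg (Real.log_nonneg one_le), ← re_trace]
  exact log_re_det_one_add_le hM

end HighPower

section Measurability

variable {X ι κ : Type*} [TopologicalSpace X] [Fintype ι] [Fintype κ] [DecidableEq κ]
  {f : X → Matrix ι κ ℂ}

lemma continuous_gramDet (hf : Continuous f) : Continuous fun x => gramDet (f x) :=
  Complex.continuous_re.comp (hf.matrix_conjTranspose.matrix_mul hf).matrix_det

lemma measurable_gramInvTrace [MeasurableSpace X] [OpensMeasurableSpace X] (hf : Continuous f) :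
    Measurable fun x => gramInvTrace (f x) := by
  have hg : Continuous fun x => (f x)ᴴ * f x := hf.matrix_conjTranspose.matrix_mul hf
  simp only [gramInvTrace, inv_def, trace_smul, Ring.inverse_eq_inv', smul_eq_mul]
  exact Complex.measurable_re.comp
    (hg.matrix_det.measurable.inv.mul hg.matrix_adjugate.matrix_trace.measurable)

lemma measurable_colSqDist [MeasurableSpace X] [OpensMeasurableSpace X] {n : ℕ}
    {f : X → Matrix ι (Fin (n + 1)) ℂ} (hf : Continuous f) (j : Fin (n + 1)) :
    Measurable fun x => colSqDist (f x) j :=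
  (continuous_gramDet hf).measurable.div
    (continuous_gramDet (hf.matrix_submatrix id j.succAbove)).measurable

end Measurability

section OneFactor

instance (m n : ℕ) : IsProbabilityMeasure (rayleighLaw m n) := by
  unfold rayleighLaw
  infer_instance

lemma measurePreserving_prod_of_ae {α β γ : Type*} [MeasurableSpace α] [MeasurableSpace β]
    [MeasurableSpace γ] {μ : Measure α} {ν : Measure β} [SFinite μ] [IsProbabilityMeasure ν]
    {ρ : Measure γ} {F : α × β → γ} (hF : Measurable F)
    (h : ∀ᵐ b ∂ν, MeasurePreserving (fun a => F (a, b)) μ ρ) :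
    MeasurePreserving F (μ.prod ν) ρ := by
  refine ⟨hF, Measure.ext fun s hs => ?_⟩
  have section_eq : ∀ᵐ b ∂ν, μ ((fun a => (a, b)) ⁻¹' (F ⁻¹' s)) = ρ s := by
    filter_upwards [h] with b hb
    exact hb.measure_preimage hs.nullMeasurableSet
  rw [Measure.map_apply hF hs, Measure.prod_apply_symm (hF hs), lintegral_congr_ae section_eq,
    lintegral_const, measure_univ, mul_one]

variable {m n : ℕ}

lemma continuous_of_transpose :
    Continuous fun c : Fin n → Fin m → ℂ => (of c)ᵀ :=
  Continuous.matrix_transpose continuous_id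

lemma measurePreserving_comp_succAbove (n m : ℕ) (j : Fin (n + 1)) :
    MeasurePreserving (fun (c : Fin (n + 1) → Fin m → ℂ) i => c (j.succAbove i))
      (rayleighLaw (n + 1) m) (rayleighLaw n m) :=
  measurePreserving_snd.comp (measurePreserving_piFinSuccAbove (fun _ => gaussVec (Fin m)) j)

lemma measurePreserving_colSqDist_of_ae (hnm : n < m) (j : Fin (n + 1))
    (hae : ∀ᵐ c ∂rayleighLaw n m, gramDet (of c)ᵀ ≠ 0) :
    MeasurePreserving (fun c => colSqDist (of c)ᵀ j) (rayleighLaw (n + 1) m)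
      (gammaMeasure (m - n) 1) := by
  have : Nonempty (Fin (m - n)) := ⟨⟨0, Nat.sub_pos_of_lt hnm⟩⟩
  have split : MeasurePreserving (MeasurableEquiv.piFinSuccAbove (fun _ => Fin m → ℂ) j)
      (rayleighLaw (n + 1) m) ((gaussVec (Fin m)).prod (rayleighLaw n m)) :=
    measurePreserving_piFinSuccAbove (fun _ => gaussVec (Fin m)) j
  have insert_law : MeasurePreserving
      (fun p : (Fin m → ℂ) × (Fin n → Fin m → ℂ) => colSqDist (of (j.insertNth p.1 p.2))ᵀ j)
      ((gaussVec (Fin m)).prod (rayleighLaw n m)) (gammaMeasure (m - n) 1) := by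
    refine measurePreserving_prod_of_ae ((measurable_colSqDist continuous_of_transpose j).comp
      (MeasurableEquiv.piFinSuccAbove (fun _ => Fin m → ℂ) j).symm.measurable) ?_
    filter_upwards [hae] with b hb
    obtain ⟨V, hV, hVB⟩ := exists_coisometry_add_projection_eq_one (p := Fin (m - n)) hb
      (by simp only [Fintype.card_fin]; omega)
    have law := (measurePreserving_sum_sq_norm_gaussVec (Fin (m - n))).comp
      (measurePreserving_mulVec_gaussVec hV)
    rw [Fintype.card_fin, Nat.cast_sub hnm.le] at law
    convert law using 2 with a
    have col_eq : (of (j.insertNth a b))ᵀ.col j = a := by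
      ext
      simp
    have submatrix_eq : (of (j.insertNth a b))ᵀ.submatrix id j.succAbove = (of b)ᵀ := by
      ext
      simp
    rw [colSqDist_eq_sum_sq_norm_mulVec submatrix_eq hb hVB, col_eq]
    rfl
  convert insert_law.comp split using 2 with c
  simp

lemma ae_gramDet_transpose_ne_zero (hnm : n ≤ m) :
    ∀ᵐ c ∂rayleighLaw n m, gramDet (of c)ᵀ ≠ 0 := by
  induction n with
  | zero => exact ae_of_all _ fun c => by simp [gramDet]
  | succ n ih =>
    have law := measurePreserving_colSqDist_of_ae hnm 0 (ih (Nat.le_of_succ_le hnm))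
    filter_upwards [law.quasiMeasurePreserving.ae (ae_gammaMeasure_pos _ _)] with c hc
    exact left_ne_zero_of_mul hc.ne'

lemma measurePreserving_colSqDist (hnm : n < m) (j : Fin (n + 1)) :
    MeasurePreserving (fun c => colSqDist (of c)ᵀ j) (rayleighLaw (n + 1) m)
      (gammaMeasure (m - n) 1) :=
  measurePreserving_colSqDist_of_ae hnm j (ae_gramDet_transpose_ne_zero hnm.le)

lemma integrable_and_integral_log_gramDet_transpose (hnm : n ≤ m) :
    Integrable (fun c => Real.log (gramDet (of c)ᵀ)) (rayleighLaw n m) ∧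
      ∫ c, Real.log (gramDet (of c)ᵀ) ∂rayleighLaw n m =
        ∑ l ∈ Finset.Icc 1 n, digamma (m - l + 1) := by
  induction n with
  | zero => simp [gramDet]
  | succ n ih =>
    obtain ⟨ih_integrable, ih_integral⟩ := ih (Nat.le_of_succ_le hnm)
    have pos : (0 : ℝ) < m - n := sub_pos.2 (Nat.cast_lt.2 hnm)
    have dist_law := measurePreserving_colSqDist hnm 0
    have rest_law := measurePreserving_comp_succAbove n m 0
    have dist_integrable :=
      dist_law.integrable_comp_of_integrable (integrable_log_gammaMeasure pos one_pos)
    have dist_integral := dist_law.hasLaw.integral_comp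
      (integrable_log_gammaMeasure pos one_pos).aestronglyMeasurable
    have rest_integrable := rest_law.integrable_comp_of_integrable ih_integrable
    have rest_integral := rest_law.hasLaw.integral_comp ih_integrable.aestronglyMeasurable
    rw [integral_log_gammaMeasure pos one_pos, Real.log_one, sub_zero] at dist_integral
    have log_eq : (fun c => Real.log (gramDet (of c)ᵀ)) =ᵐ[rayleighLaw (n + 1) m]
        (Real.log ∘ fun c => colSqDist (of c)ᵀ 0) +
          ((fun c => Real.log (gramDet (of c)ᵀ)) ∘ fun c i => c (Fin.succAbove 0 i)) := by
      filter_upwards [ae_gramDet_transpose_ne_zero hnm, rest_law.quasiMeasurePreserving.ae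
        (ae_gramDet_transpose_ne_zero (Nat.le_of_succ_le hnm))] with c hc hrest
      exact eq_add_of_sub_eq (Real.log_div hc hrest).symm
    refine ⟨(dist_integrable.add rest_integrable).congr log_eq.symm, ?_⟩
    rw [integral_congr_ae log_eq, integral_add' dist_integrable rest_integrable, dist_integral,
      rest_integral, ih_integral, Finset.sum_Icc_succ_top (Nat.le_add_left 1 n), add_comm]
    push_cast
    ring_nf

lemma sqrt_sum_le {ι : Type*} (s : Finset ι) {f : ι → ℝ} (hf : ∀ i, 0 ≤ f i) :
    √(∑ i ∈ s, f i) ≤ ∑ i ∈ s, √(f i) := by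
  refine Finset.le_sum_of_subadditive_on_pred (√·) (0 ≤ ·) Real.sqrt_zero.le (fun x y hx hy => ?_)
    (fun _ _ => add_nonneg) f fun i _ => hf i
  rw [Real.sqrt_le_left (by positivity)]
  nlinarith [Real.sq_sqrt hx, Real.sq_sqrt hy, mul_nonneg (Real.sqrt_nonneg x) (Real.sqrt_nonneg y)]

lemma lintegral_sqrt_inv_colSqDist_le (hnm : n < m) (j : Fin (n + 1)) :
    ∫⁻ c, ENNReal.ofReal √(colSqDist (of c)ᵀ j)⁻¹ ∂rayleighLaw (n + 1) m ≤
      ENNReal.ofReal (2 * √(n + 1) / √m) := by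
  obtain ⟨k, rfl⟩ := Nat.exists_eq_add_of_lt hnm
  have one_le : (1 : ℝ) ≤ (n + k + 1 : ℕ) - n := by
    push_cast
    linarith [Nat.cast_nonneg (α := ℝ) k]
  rw [(measurePreserving_colSqDist hnm j).lintegral_comp
    (f := fun x => ENNReal.ofReal √x⁻¹) (by fun_prop)]
  refine (lintegral_sqrt_inv_gammaMeasure_le one_le).trans (ENNReal.ofReal_le_ofReal ?_)
  rw [div_le_div_iff₀ (by positivity) (by positivity), mul_assoc, ← Real.sqrt_mul (by positivity)]
  gcongr
  push_cast
  nlinarith [mul_nonneg (Nat.cast_nonneg (α := ℝ) n) (Nat.cast_nonneg (α := ℝ) k)]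

lemma lintegral_sqrt_gramInvTrace_transpose_le (hnm : n ≤ m) :
    ∫⁻ c, ENNReal.ofReal √(gramInvTrace (of c)ᵀ) ∂rayleighLaw n m ≤
      ENNReal.ofReal (2 * n * √n / √m) := by
  cases n with
  | zero => simp [gramInvTrace, trace]
  | succ n =>
    calc ∫⁻ c, ENNReal.ofReal √(gramInvTrace (of c)ᵀ) ∂rayleighLaw (n + 1) m
        ≤ ∫⁻ c, ∑ j, ENNReal.ofReal √(colSqDist (of c)ᵀ j)⁻¹ ∂rayleighLaw (n + 1) m := by
          refine lintegral_mono fun c => ?_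
          rw [← ENNReal.ofReal_sum_of_nonneg fun j _ => Real.sqrt_nonneg _,
            gramInvTrace_eq_sum_inv_colSqDist]
          exact ENNReal.ofReal_le_ofReal
            (sqrt_sum_le _ fun j => inv_nonneg.2 (colSqDist_nonneg _ j))
      _ = ∑ j, ∫⁻ c, ENNReal.ofReal √(colSqDist (of c)ᵀ j)⁻¹ ∂rayleighLaw (n + 1) m :=
          lintegral_finsetSum _ fun j _ =>
            (measurable_colSqDist continuous_of_transpose j).inv.sqrt.ennreal_ofReal
      _ ≤ ∑ _j : Fin (n + 1), ENNReal.ofReal (2 * √(n + 1) / √m) :=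
          Finset.sum_le_sum fun j _ => lintegral_sqrt_inv_colSqDist_le hnm j
      _ = ENNReal.ofReal (2 * (n + 1 : ℕ) * √(n + 1 : ℕ) / √m) := by
          rw [← ENNReal.ofReal_sum_of_nonneg fun _ _ => by positivity, Finset.sum_const,
            Finset.card_univ, Fintype.card_fin, nsmul_eq_mul]
          push_cast
          ring_nf

lemma measurePreserving_swap_rayleighLaw (m n : ℕ) :
    MeasurePreserving (fun (Q : Fin m → Fin n → ℂ) j i => Q i j) (rayleighLaw m n)
      (rayleighLaw n m) :=
  measurePreserving_swap_pi (Fin m) (Fin n) complexGaussian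

lemma ae_gramDet_ne_zero (hnm : n ≤ m) : ∀ᵐ Q ∂rayleighLaw m n, gramDet (of Q) ≠ 0 :=
  (measurePreserving_swap_rayleighLaw m n).quasiMeasurePreserving.ae
    (ae_gramDet_transpose_ne_zero hnm)

lemma integrable_log_gramDet (hnm : n ≤ m) :
    Integrable (fun Q => Real.log (gramDet (of Q))) (rayleighLaw m n) :=
  (measurePreserving_swap_rayleighLaw m n).integrable_comp_of_integrable
    (integrable_and_integral_log_gramDet_transpose hnm).1

lemma integral_log_gramDet (hnm : n ≤ m) :
    ∫ Q, Real.log (gramDet (of Q)) ∂rayleighLaw m n =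
      ∑ l ∈ Finset.Icc 1 n, digamma (m - l + 1) := by
  obtain ⟨log_integrable, log_integral⟩ := integrable_and_integral_log_gramDet_transpose hnm
  rw [← log_integral, ← (measurePreserving_swap_rayleighLaw m n).hasLaw.integral_comp
    log_integrable.aestronglyMeasurable]
  rfl

lemma lintegral_sqrt_gramInvTrace_le (hnm : n ≤ m) :
    ∫⁻ Q, ENNReal.ofReal √(gramInvTrace (of Q)) ∂rayleighLaw m n ≤
      ENNReal.ofReal (2 * n * √n / √m) := by
  refine Eq.trans_le ?_ (lintegral_sqrt_gramInvTrace_transpose_le hnm)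
  exact (measurePreserving_swap_rayleighLaw m n).lintegral_comp
    (measurable_gramInvTrace continuous_of_transpose).sqrt.ennreal_ofReal

end OneFactor

section FixedFactor

variable {N m n : ℕ} {A : Matrix (Fin m) (Fin n) ℂ}

/- Writing `A = U R` with `U` an isometry and `R` square, `φ` is `Q ↦ Q U`. -/
lemma exists_measurePreserving_gramDet_mul (N : ℕ) (hA : gramDet A ≠ 0) :
    ∃ φ : (Fin N → Fin m → ℂ) → Fin N → Fin n → ℂ,
      MeasurePreserving φ (rayleighLaw N m) (rayleighLaw N n) ∧
        ∀ Q, gramDet (of Q * A) = gramDet (of (φ Q)) * gramDet A ∧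
          gramInvTrace (of Q * A) ≤ gramInvTrace (of (φ Q)) * gramInvTrace A := by
  obtain ⟨U, R, hU, hA_eq, hR⟩ := exists_isometry_mul hA
  have hUT : Uᵀ * Uᵀᴴ = 1 := by
    have := congrArg transpose hU
    rwa [transpose_mul, transpose_one] at this
  refine ⟨fun Q i => Uᵀ *ᵥ Q i, measurePreserving_pi _ _ fun _ : Fin N =>
    measurePreserving_mulVec_gaussVec hUT, fun Q => ?_⟩
  have mul_eq : of Q * A = of (fun i => Uᵀ *ᵥ Q i) * R := by
    rw [hA_eq, ← Matrix.mul_assoc]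
    congr 1
    ext i j
    rw [of_apply, mulVec_transpose]
    rfl
  rw [mul_eq, gramDet_mul, gramDet_congr hR, ← gramInvTrace_congr hR]
  exact ⟨rfl, gramInvTrace_mul_le _ _⟩

lemma measurePreserving_gramDet_mul_div (N : ℕ) (hA : gramDet A ≠ 0) :
    MeasurePreserving (fun Q => gramDet (of Q * A) / gramDet A) (rayleighLaw N m)
      ((rayleighLaw N n).map fun Q => gramDet (of Q)) := by
  obtain ⟨φ, hφ, hφA⟩ := exists_measurePreserving_gramDet_mul N hA
  have hmeas : Measurable fun Q : Fin N → Fin n → ℂ => gramDet (of Q) :=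
    (continuous_gramDet (by fun_prop)).measurable
  convert (hmeas.measurePreserving _).comp hφ using 2 with Q
  rw [(hφA Q).1, mul_div_cancel_right₀ _ hA]
  rfl

lemma lintegral_sqrt_gramInvTrace_mul_le (hnN : n ≤ N) (hA : gramDet A ≠ 0) :
    ∫⁻ Q, ENNReal.ofReal √(gramInvTrace (of Q * A)) ∂rayleighLaw N m ≤
      ENNReal.ofReal (2 * n * √n / √N) * ENNReal.ofReal √(gramInvTrace A) := by
  obtain ⟨φ, hφ, hφA⟩ := exists_measurePreserving_gramDet_mul N hA
  have hmeas : Measurable fun Q : Fin N → Fin n → ℂ => ENNReal.ofReal √(gramInvTrace (of Q)) :=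
    (measurable_gramInvTrace (by fun_prop)).sqrt.ennreal_ofReal
  calc ∫⁻ Q, ENNReal.ofReal √(gramInvTrace (of Q * A)) ∂rayleighLaw N m
      ≤ ∫⁻ Q, ENNReal.ofReal √(gramInvTrace (of (φ Q))) *
          ENNReal.ofReal √(gramInvTrace A) ∂rayleighLaw N m := by
        refine lintegral_mono fun Q => ?_
        rw [← ENNReal.ofReal_mul (Real.sqrt_nonneg _), ← Real.sqrt_mul (gramInvTrace_nonneg _)]
        gcongr
        exact (hφA Q).2
    _ = (∫⁻ Q, ENNReal.ofReal √(gramInvTrace (of Q)) ∂rayleighLaw N n) *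
          ENNReal.ofReal √(gramInvTrace A) := by
        rw [← hφ.lintegral_comp hmeas]
        exact lintegral_mul_const _ (hmeas.comp hφ.measurable)
    _ ≤ ENNReal.ofReal (2 * n * √n / √N) * ENNReal.ofReal √(gramInvTrace A) := by
        gcongr
        exact lintegral_sqrt_gramInvTrace_le hnN

end FixedFactor

section Product

variable {K : ℕ} {N : ℕ → ℕ}

instance : IsProbabilityMeasure (factorsLaw K N) := by
  unfold factorsLaw
  infer_instance

/-- The first `K` factors `Q_1, …, Q_K` of a product channel with `K + 1` factors. -/
def initFactors (Q : Factors (K + 1) N) : Factors K N := fun k => Q k.castSucc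

lemma continuous_channel (K : ℕ) (N : ℕ → ℕ) : Continuous (channel K N) := by
  induction K with
  | zero => exact continuous_const
  | succ K ih =>
    have last_factor : Continuous fun Q : Factors (K + 1) N => of (Q (Fin.last K)) :=
      continuous_apply (Fin.last K)
    exact last_factor.matrix_mul (ih.comp (by fun_prop))

lemma continuous_of_mul_channel (K : ℕ) (N : ℕ → ℕ) :
    Continuous fun p : (Fin (N (K + 1)) → Fin (N K) → ℂ) × Factors K N =>
      of p.1 * channel K N p.2 :=
  Continuous.matrix_mul (A := fun p : (Fin (N (K + 1)) → Fin (N K) → ℂ) × Factors K N => of p.1)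
    continuous_fst ((continuous_channel K N).comp continuous_snd)

lemma measurePreserving_last_initFactors (K : ℕ) (N : ℕ → ℕ) :
    MeasurePreserving (fun Q : Factors (K + 1) N => (Q (Fin.last K), initFactors Q))
      (factorsLaw (K + 1) N) ((rayleighLaw (N (K + 1)) (N K)).prod (factorsLaw K N)) := by
  have split : MeasurePreserving
      (fun (Q : Factors (K + 1) N) => (Q (Fin.last K), fun k => Q ((Fin.last K).succAbove k)))
      (factorsLaw (K + 1) N) ((rayleighLaw (N (K + 1)) (N K)).prod
        (Measure.pi fun k => rayleighLaw (N ((Fin.last K).succAbove k + 1))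
          (N ((Fin.last K).succAbove k)))) :=
    measurePreserving_piFinSuccAbove
      (fun k : Fin (K + 1) => rayleighLaw (N (k + 1)) (N k)) (Fin.last K)
  rw [Fin.succAbove_last] at split
  exact split

lemma measurePreserving_initFactors (K : ℕ) (N : ℕ → ℕ) :
    MeasurePreserving initFactors (factorsLaw (K + 1) N) (factorsLaw K N) :=
  measurePreserving_snd.comp (measurePreserving_last_initFactors K N)

lemma measurePreserving_gramDet_channel_div
    (hae : ∀ᵐ Q ∂factorsLaw K N, gramDet (channel K N Q) ≠ 0) :
    MeasurePreserving
      (fun Q => gramDet (channel (K + 1) N Q) / gramDet (channel K N (initFactors Q)))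
      (factorsLaw (K + 1) N)
      ((rayleighLaw (N (K + 1)) (N 0)).map fun Q => gramDet (of Q)) := by
  have ratio_law : MeasurePreserving
      (fun p : (Fin (N (K + 1)) → Fin (N K) → ℂ) × Factors K N =>
        gramDet (of p.1 * channel K N p.2) / gramDet (channel K N p.2))
      ((rayleighLaw (N (K + 1)) (N K)).prod (factorsLaw K N))
      ((rayleighLaw (N (K + 1)) (N 0)).map fun Q => gramDet (of Q)) := by
    refine measurePreserving_prod_of_ae
      ((continuous_gramDet (continuous_of_mul_channel K N)).measurable.div
        ((continuous_gramDet (continuous_channel K N)).measurable.comp measurable_snd)) ?_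
    filter_upwards [hae] with Q hQ
    exact measurePreserving_gramDet_mul_div _ hQ
  exact (ratio_law.comp (measurePreserving_last_initFactors K N) :)

lemma ae_gramDet_channel_ne_zero (hN : ∀ k ∈ Finset.Icc 1 K, N 0 ≤ N k) :
    ∀ᵐ Q ∂factorsLaw K N, gramDet (channel K N Q) ≠ 0 := by
  induction K with
  | zero => exact ae_of_all _ fun Q => by simp [channel, gramDet]
  | succ K ih =>
    have law := measurePreserving_gramDet_channel_div
      (ih fun k hk => hN k (Finset.Icc_subset_Icc_right K.le_succ hk))
    have ratio_ne_zero :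
        ∀ᵐ x ∂(rayleighLaw (N (K + 1)) (N 0)).map (fun Q => gramDet (of Q)), x ≠ 0 :=
      (ae_map_iff (continuous_gramDet (by fun_prop)).aemeasurable
        (measurableSet_singleton 0).compl).2
        (ae_gramDet_ne_zero (hN (K + 1) (Finset.right_mem_Icc.2 (Nat.le_add_left 1 K))))
    filter_upwards [law.quasiMeasurePreserving.ae ratio_ne_zero] with Q hQ
    exact (div_ne_zero_iff.1 hQ).1

/-- The constant term of the high-SNR expansion of the ergodic capacity, equal to the mean of
`log det (Hᴴ H)`. -/
def capacityOffset (K : ℕ) (N : ℕ → ℕ) : ℝ :=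
  ∑ k ∈ Finset.Icc 1 K, ∑ l ∈ Finset.Icc 1 (N 0), digamma (N k - l + 1)

lemma integrable_and_integral_log_gramDet_channel (hN : ∀ k ∈ Finset.Icc 1 K, N 0 ≤ N k) :
    Integrable (fun Q => Real.log (gramDet (channel K N Q))) (factorsLaw K N) ∧
      ∫ Q, Real.log (gramDet (channel K N Q)) ∂factorsLaw K N = capacityOffset K N := by
  induction K with
  | zero => simp [channel, gramDet, capacityOffset]
  | succ K ih =>
    have hN' : ∀ k ∈ Finset.Icc 1 K, N 0 ≤ N k := fun k hk =>
      hN k (Finset.Icc_subset_Icc_right K.le_succ hk)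
    have hK : N 0 ≤ N (K + 1) := hN (K + 1) (Finset.right_mem_Icc.2 (Nat.le_add_left 1 K))
    obtain ⟨ih_integrable, ih_integral⟩ := ih hN'
    have gramDet_aemeasurable : AEMeasurable
        (fun Q => gramDet (of Q)) (rayleighLaw (N (K + 1)) (N 0)) :=
      (continuous_gramDet (by fun_prop)).aemeasurable
    have log_measurable := Real.measurable_log.aestronglyMeasurable
      (μ := (rayleighLaw (N (K + 1)) (N 0)).map fun Q => gramDet (of Q))
    have ratio_law := measurePreserving_gramDet_channel_div (ae_gramDet_channel_ne_zero hN')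
    have rest_law := measurePreserving_initFactors K N
    have ratio_integrable := ratio_law.integrable_comp_of_integrable
      ((integrable_map_measure log_measurable gramDet_aemeasurable).2 (integrable_log_gramDet hK))
    have ratio_integral := ratio_law.hasLaw.integral_comp log_measurable
    rw [integral_map gramDet_aemeasurable log_measurable, integral_log_gramDet hK] at ratio_integral
    have rest_integrable := rest_law.integrable_comp_of_integrable ih_integrable
    have rest_integral := rest_law.hasLaw.integral_comp ih_integrable.aestronglyMeasurable
    have log_eq : (fun Q => Real.log (gramDet (channel (K + 1) N Q))) =ᵐ[factorsLaw (K + 1) N]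
        (Real.log ∘ fun Q =>
            gramDet (channel (K + 1) N Q) / gramDet (channel K N (initFactors Q))) +
          (fun Q => Real.log (gramDet (channel K N Q))) ∘ initFactors := by
      filter_upwards [ae_gramDet_channel_ne_zero hN, rest_law.quasiMeasurePreserving.ae
        (ae_gramDet_channel_ne_zero hN')] with Q hQ hrest
      exact eq_add_of_sub_eq (Real.log_div hQ hrest).symm
    refine ⟨(ratio_integrable.add rest_integrable).congr log_eq.symm, ?_⟩
    rw [integral_congr_ae log_eq, integral_add' ratio_integrable rest_integrable, ratio_integral,
      rest_integral, ih_integral, capacityOffset, capacityOffset,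
      Finset.sum_Icc_succ_top (Nat.le_add_left 1 K), add_comm]

lemma lintegral_sqrt_gramInvTrace_channel_le (hN : ∀ k ∈ Finset.Icc 1 K, N 0 ≤ N k) :
    ∫⁻ Q, ENNReal.ofReal √(gramInvTrace (channel K N Q)) ∂factorsLaw K N ≤
      ENNReal.ofReal (√(N 0) * ∏ k ∈ Finset.Icc 1 K, (2 * N 0 * √(N 0) / √(N k))) := by
  induction K with
  | zero => simp [channel, gramInvTrace]
  | succ K ih =>
    have hN' : ∀ k ∈ Finset.Icc 1 K, N 0 ≤ N k := fun k hk =>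
      hN k (Finset.Icc_subset_Icc_right K.le_succ hk)
    have hK : N 0 ≤ N (K + 1) := hN (K + 1) (Finset.right_mem_Icc.2 (Nat.le_add_left 1 K))
    have hmeas : Measurable fun p : (Fin (N (K + 1)) → Fin (N K) → ℂ) × Factors K N =>
        ENNReal.ofReal √(gramInvTrace (of p.1 * channel K N p.2)) :=
      (measurable_gramInvTrace (continuous_of_mul_channel K N)).sqrt.ennreal_ofReal
    set c : ℝ := 2 * N 0 * √(N 0) / √(N (K + 1))
    calc ∫⁻ Q, ENNReal.ofReal √(gramInvTrace (channel (K + 1) N Q)) ∂factorsLaw (K + 1) N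
        = ∫⁻ p, ENNReal.ofReal √(gramInvTrace (of p.1 * channel K N p.2))
            ∂(rayleighLaw (N (K + 1)) (N K)).prod (factorsLaw K N) :=
          (measurePreserving_last_initFactors K N).lintegral_comp hmeas
      _ = ∫⁻ Q', ∫⁻ Q, ENNReal.ofReal √(gramInvTrace (of Q * channel K N Q'))
            ∂rayleighLaw (N (K + 1)) (N K) ∂factorsLaw K N :=
          lintegral_prod_symm _ hmeas.aemeasurable
      _ ≤ ∫⁻ Q', ENNReal.ofReal c * ENNReal.ofReal √(gramInvTrace (channel K N Q'))
            ∂factorsLaw K N := by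
          refine lintegral_mono_ae ?_
          filter_upwards [ae_gramDet_channel_ne_zero hN'] with Q' hQ'
          exact lintegral_sqrt_gramInvTrace_mul_le hK hQ'
      _ ≤ ENNReal.ofReal c * ENNReal.ofReal
            (√(N 0) * ∏ k ∈ Finset.Icc 1 K, (2 * N 0 * √(N 0) / √(N k))) := by
          rw [lintegral_const_mul' _ _ ENNReal.ofReal_ne_top]
          gcongr
          exact ih hN'
      _ = ENNReal.ofReal
            (√(N 0) * ∏ k ∈ Finset.Icc 1 (K + 1), (2 * N 0 * √(N 0) / √(N k))) := by
          rw [← ENNReal.ofReal_mul (by positivity),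
            Finset.prod_Icc_succ_top (Nat.le_add_left 1 K), mul_comm, mul_assoc]

end Product

section Capacity

variable {K : ℕ} {N : ℕ → ℕ}

lemma measurable_capacity (K : ℕ) (N : ℕ → ℕ) (q : ℝ) : Measurable (capacity K N q) := by
  have gram_continuous : Continuous fun Q : Factors K N => (channel K N Q)ᴴ * channel K N Q :=
    (continuous_channel K N).matrix_conjTranspose.matrix_mul (continuous_channel K N)
  exact (Complex.continuous_re.comp
    (continuous_const.add (gram_continuous.const_smul (q : ℂ))).matrix_det).measurable.log

lemma ae_abs_capacity_sub_le (hN : ∀ k ∈ Finset.Icc 1 K, N 0 ≤ N k) {q : ℝ} (hq : 0 < q) :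
    ∀ᵐ Q ∂factorsLaw K N,
      |capacity K N q Q - (N 0 * Real.log q + Real.log (gramDet (channel K N Q)))| ≤
        2 * N 0 / √q * √(gramInvTrace (channel K N Q)) := by
  filter_upwards [ae_gramDet_channel_ne_zero hN] with Q hQ
  convert abs_log_det_one_add_smul_sub_le hQ hq using 1
  · rw [Fintype.card_fin]
    rfl
  · rw [Fintype.card_fin, Real.sqrt_div (gramInvTrace_nonneg _)]
    ring

lemma integrable_sqrt_gramInvTrace_channel (hN : ∀ k ∈ Finset.Icc 1 K, N 0 ≤ N k) :
    Integrable (fun Q => √(gramInvTrace (channel K N Q))) (factorsLaw K N) := by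
  refine ⟨(measurable_gramInvTrace (continuous_channel K N)).sqrt.aestronglyMeasurable, ?_⟩
  rw [hasFiniteIntegral_iff_ofReal (ae_of_all _ fun _ => Real.sqrt_nonneg _)]
  exact (lintegral_sqrt_gramInvTrace_channel_le hN).trans_lt ENNReal.ofReal_lt_top

lemma integral_sqrt_gramInvTrace_channel_le (hN : ∀ k ∈ Finset.Icc 1 K, N 0 ≤ N k) :
    ∫ Q, √(gramInvTrace (channel K N Q)) ∂factorsLaw K N ≤
      √(N 0) * ∏ k ∈ Finset.Icc 1 K, (2 * N 0 * √(N 0) / √(N k)) := by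
  rw [integral_eq_lintegral_of_nonneg_ae (ae_of_all _ fun _ => Real.sqrt_nonneg _)
    (integrable_sqrt_gramInvTrace_channel hN).aestronglyMeasurable]
  exact ENNReal.toReal_le_of_le_ofReal (by positivity) (lintegral_sqrt_gramInvTrace_channel_le hN)

lemma integrable_const_add_log_gramDet_channel (hN : ∀ k ∈ Finset.Icc 1 K, N 0 ≤ N k) (c : ℝ) :
    Integrable (fun Q => c + Real.log (gramDet (channel K N Q))) (factorsLaw K N) :=
  (integrable_const c).add (integrable_and_integral_log_gramDet_channel hN).1

lemma integrable_capacity (hN : ∀ k ∈ Finset.Icc 1 K, N 0 ≤ N k) {q : ℝ} (hq : 0 < q) :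
    Integrable (capacity K N q) (factorsLaw K N) := by
  have approx_integrable := integrable_const_add_log_gramDet_channel hN (N 0 * Real.log q)
  have diff_integrable := ((integrable_sqrt_gramInvTrace_channel hN).const_mul _).mono'
    ((measurable_capacity K N q).aestronglyMeasurable.sub approx_integrable.aestronglyMeasurable)
    (ae_abs_capacity_sub_le hN hq)
  exact (diff_integrable.add approx_integrable).congr (ae_of_all _ fun Q => sub_add_cancel _ _)

lemma abs_ergodicCapacity_sub_le (hN : ∀ k ∈ Finset.Icc 1 K, N 0 ≤ N k) {q : ℝ} (hq : 0 < q) :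
    |ergodicCapacity K N q - (N 0 * Real.log q + capacityOffset K N)| ≤
      2 * N 0 * (√(N 0) * (2 * N 0 * √(N 0)) ^ K) / √(snr K N q) := by
  obtain ⟨log_integrable, log_integral⟩ := integrable_and_integral_log_gramDet_channel hN
  have approx_integrable := integrable_const_add_log_gramDet_channel hN (N 0 * Real.log q)
  have diff_eq : ergodicCapacity K N q - (N 0 * Real.log q + capacityOffset K N) =
      ∫ Q, (capacity K N q Q - (N 0 * Real.log q + Real.log (gramDet (channel K N Q))))
        ∂factorsLaw K N := by
    rw [integral_sub (integrable_capacity hN hq) approx_integrable,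
      integral_add (integrable_const _) log_integrable, log_integral, integral_const,
      probReal_univ, one_smul, ergodicCapacity]
  rw [diff_eq, ← Real.norm_eq_abs]
  calc ‖∫ Q, (capacity K N q Q - (N 0 * Real.log q + Real.log (gramDet (channel K N Q))))
          ∂factorsLaw K N‖
      ≤ ∫ Q, 2 * N 0 / √q * √(gramInvTrace (channel K N Q)) ∂factorsLaw K N :=
        norm_integral_le_of_norm_le ((integrable_sqrt_gramInvTrace_channel hN).const_mul _)
          (ae_abs_capacity_sub_le hN hq)
    _ ≤ 2 * N 0 / √q * (√(N 0) * ∏ k ∈ Finset.Icc 1 K, (2 * N 0 * √(N 0) / √(N k))) := by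
        rw [integral_const_mul]
        gcongr
        exact integral_sqrt_gramInvTrace_channel_le hN
    _ = 2 * N 0 * (√(N 0) * (2 * N 0 * √(N 0)) ^ K) / √(snr K N q) := by
        rw [snr, Real.sqrt_mul hq.le, Finset.prod_div_distrib, Finset.prod_const, Nat.card_Icc,
          Nat.add_sub_cancel, Real.sqrt_prod _ fun _ _ => Nat.cast_nonneg _]
        ring

lemma exists_forall_abs_ergodicCapacity_sub_lt (K N₀ : ℕ) {ε : ℝ} (hε : 0 < ε) :
    ∃ S : ℝ, 0 < S ∧ ∀ N : ℕ → ℕ, N 0 = N₀ → (∀ k ∈ Finset.Icc 1 K, N₀ ≤ N k) →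
      ∀ q : ℝ, 0 < q → S ≤ snr K N q →
        |ergodicCapacity K N q - (N₀ * Real.log q + capacityOffset K N)| < ε := by
  set C : ℝ := 2 * N₀ * (√N₀ * (2 * N₀ * √N₀) ^ K)
  have tendsto_zero : Filter.Tendsto (fun S : ℝ => C / √S) Filter.atTop (nhds 0) :=
    Filter.Tendsto.const_div_atTop Real.tendsto_sqrt_atTop C
  obtain ⟨S, hS⟩ := Filter.eventually_atTop.1 (tendsto_zero.eventually_lt_const hε)
  refine ⟨max S 1, by positivity, ?_⟩
  rintro N rfl hN q hq hsnr
  exact (abs_ergodicCapacity_sub_le hN hq).trans_lt (hS _ ((le_max_left S 1).trans hsnr))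

lemma exists_forall_abs_ergodicCapacity_sub_sub_lt (K N₀ : ℕ) {ε : ℝ} (hε : 0 < ε) :
    ∃ S : ℝ, 0 < S ∧ ∀ N N' : ℕ → ℕ, N 0 = N₀ → N' 0 = N₀ →
      (∀ k ∈ Finset.Icc 1 K, N₀ ≤ N k) → (∀ k ∈ Finset.Icc 1 K, N₀ ≤ N' k) →
      ∀ q : ℝ, 0 < q → S ≤ snr K N q → S ≤ snr K N' q →
        |(ergodicCapacity K N q - ergodicCapacity K N' q) -
          (capacityOffset K N - capacityOffset K N')| < ε := by
  obtain ⟨S, hS, expansion⟩ := exists_forall_abs_ergodicCapacity_sub_lt K N₀ (half_pos hε)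
  refine ⟨S, hS, fun N N' h0 h0' hN hN' q hq hsnr hsnr' => ?_⟩
  have hN_lt := expansion N h0 hN q hq hsnr
  have hN'_lt := expansion N' h0' hN' q hq hsnr'
  rw [abs_lt] at *
  constructor <;> linarith

end Capacity

section Digamma

lemma digamma_add_one {x : ℝ} (hx : 0 < x) : digamma (x + 1) = digamma x + 1 / x := by
  rw [digamma, digamma, Complex.ofReal_add, Complex.ofReal_one,
    Complex.digamma_apply_add_one _ (ofReal_ne_neg_natCast hx), Complex.add_re,
    ← Complex.ofReal_inv, Complex.ofReal_re, one_div]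

lemma digamma_sub_eq_sum {M N l : ℕ} (hlM : l ≤ M) (hMN : M ≤ N) :
    digamma (N - l + 1) - digamma (M - l + 1) = ∑ s ∈ Finset.Ico M N, 1 / ((s : ℝ) - l + 1) := by
  rw [Finset.sum_congr rfl fun s hs => ?_,
    Finset.sum_Ico_sub (fun s : ℕ => digamma (s - l + 1)) hMN]
  have hls : (l : ℝ) ≤ s := Nat.cast_le.2 (hlM.trans (Finset.mem_Ico.1 hs).1)
  rw [Nat.cast_succ, show (s : ℝ) + 1 - l + 1 = s - l + 1 + 1 by ring,
    digamma_add_one (by linarith), add_sub_cancel_left]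

end Digamma

variable {K : ℕ} {N N' : ℕ → ℕ} {k : ℕ}

lemma capacityOffset_sub (h0 : N 0 = N' 0) :
    capacityOffset K N - capacityOffset K N' = ∑ k ∈ Finset.Icc 1 K, ∑ l ∈ Finset.Icc 1 (N 0),
      (digamma (N k - l + 1) - digamma (N' k - l + 1)) := by
  simp only [capacityOffset, h0, Finset.sum_sub_distrib]

lemma capacityOffset_update_sub (hk : k ∈ Finset.Icc 1 K) (hN : N 0 ≤ N k) :
    capacityOffset K (Function.update N k (N k + 1)) - capacityOffset K N =
      ∑ l ∈ Finset.Icc 1 (N 0), 1 / ((N k : ℝ) - l + 1) := by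
  have hk0 : 0 ≠ k := (Nat.succ_le_iff.1 (Finset.mem_Icc.1 hk).1).ne
  rw [capacityOffset_sub (Function.update_of_ne hk0 _ _), Function.update_of_ne hk0,
    Finset.sum_eq_single_of_mem k hk fun j _ hj => by simp [hj], Function.update_self]
  refine Finset.sum_congr rfl fun l hl => ?_
  rw [digamma_sub_eq_sum ((Finset.mem_Icc.1 hl).2.trans hN) (Nat.le_succ _),
    Nat.succ_eq_add_one, Nat.Ico_succ_singleton, Finset.sum_singleton]

lemma snr_mono (h : ∀ k ∈ Finset.Icc 1 K, N k ≤ N' k) {q : ℝ} (hq : 0 ≤ q) :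
    snr K N q ≤ snr K N' q := by
  unfold snr
  gcongr with k hk
  exact h k hk

end RayleighProduct

end

theorem mainTheorem6 (K N₀ : ℕ) (hK : 1 ≤ K) (hN₀ : 1 ≤ N₀) :
    -- the ergodic capacities are expectations of integrable random variables
    (∀ N : ℕ → ℕ, N 0 = N₀ → (∀ k ∈ Finset.Icc 1 K, N₀ ≤ N k) → ∀ q : ℝ, 0 < q →
      Integrable (RayleighProduct.capacity K N q) (RayleighProduct.factorsLaw K N)) ∧
    -- the increment over the all-square setting, when both settings are at high SNR
    (∀ ε : ℝ, 0 < ε → ∃ S : ℝ, 0 < S ∧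
      ∀ N : ℕ → ℕ, N 0 = N₀ → (∀ k ∈ Finset.Icc 1 K, N₀ ≤ N k) → ∀ q : ℝ, 0 < q →
        S ≤ RayleighProduct.snr K N q → S ≤ RayleighProduct.snr K (fun _ => N₀) q →
        |(RayleighProduct.ergodicCapacity K N q -
            RayleighProduct.ergodicCapacity K (fun _ => N₀) q) -
          ∑ k ∈ Finset.Icc 1 K, ∑ l ∈ Finset.Icc 1 N₀,
            (RayleighProduct.digamma ((N k : ℝ) - l + 1) -
              RayleighProduct.digamma ((N₀ : ℝ) - l + 1))| < ε) ∧
    -- the closed form of that increment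
    (∀ N : ℕ → ℕ, N 0 = N₀ → (∀ k ∈ Finset.Icc 1 K, N₀ ≤ N k) →
      ∑ k ∈ Finset.Icc 1 K, ∑ l ∈ Finset.Icc 1 N₀,
          (RayleighProduct.digamma ((N k : ℝ) - l + 1) -
            RayleighProduct.digamma ((N₀ : ℝ) - l + 1)) =
        ∑ k ∈ Finset.Icc 1 K, ∑ l ∈ Finset.Icc 1 N₀, ∑ s ∈ Finset.Ico N₀ (N k),
          1 / ((s : ℝ) - l + 1)) ∧
    -- the increment from one more antenna at tier `k`, at high SNR
    (∀ ε : ℝ, 0 < ε → ∃ S : ℝ, 0 < S ∧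
      ∀ N : ℕ → ℕ, N 0 = N₀ → (∀ k ∈ Finset.Icc 1 K, N₀ ≤ N k) →
        ∀ k ∈ Finset.Icc 1 K, ∀ q : ℝ, 0 < q → S ≤ RayleighProduct.snr K N q →
        |(RayleighProduct.ergodicCapacity K (Function.update N k (N k + 1)) q -
            RayleighProduct.ergodicCapacity K N q) -
          ∑ l ∈ Finset.Icc 1 N₀, 1 / ((N k : ℝ) - l + 1)| < ε) := by
  refine ⟨?_, fun ε hε => ?_, fun N _ hN => ?_, fun ε hε => ?_⟩
  · rintro N rfl hN q hq
    exact RayleighProduct.integrable_capacity hN hq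
  · obtain ⟨S, hS, increment⟩ :=
      RayleighProduct.exists_forall_abs_ergodicCapacity_sub_sub_lt K N₀ hε
    refine ⟨S, hS, ?_⟩
    rintro N rfl hN q hq hsnr hsnr_square
    rw [← RayleighProduct.capacityOffset_sub (N' := fun _ => N 0) rfl]
    exact increment N (fun _ => N 0) rfl rfl hN (fun _ _ => le_rfl) q hq hsnr
      hsnr_square
  · exact Finset.sum_congr rfl fun k hk => Finset.sum_congr rfl fun l hl =>
      RayleighProduct.digamma_sub_eq_sum (Finset.mem_Icc.1 hl).2 (hN k hk)
  · obtain ⟨S, hS, increment⟩ :=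
      RayleighProduct.exists_forall_abs_ergodicCapacity_sub_sub_lt K N₀ hε
    refine ⟨S, hS, ?_⟩
    rintro N rfl hN k hk q hq hsnr
    have hk0 : 0 ≠ k := (Nat.succ_le_iff.1 (Finset.mem_Icc.1 hk).1).ne
    have hle (j : ℕ) : N j ≤ Function.update N k (N k + 1) j :=
      le_update_iff.2 ⟨Nat.le_succ _, fun _ _ => le_rfl⟩ j
    rw [← RayleighProduct.capacityOffset_update_sub hk (hN k hk)]
    exact increment _ N (Function.update_of_ne hk0 _ _) rfl (fun j hj => (hN j hj).trans (hle j))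
      hN q hq (hsnr.trans (RayleighProduct.snr_mono (fun j _ => hle j) hq.le)) hsnr
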